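/- Let $\mathbb F$ be a field and let $\mathcal P=(\mathcal A,\mathcal B)$ be a pair of linear mappings $\mathcal A,\mathcal B:U\to V$ between finite-dimensional vector spaces over $\mathbb F$. For $k\ge 1$ let $I_k$ be the $k\times k$ identity matrix, let $J_k(0)$ be the $k\times k$ singular Jordan block with units under the diagonal, and let $L_k$ and $R_k$ be the $(k-1)\times k$ matrices obtained from $I_k$ by deleting its last, respectively first, row (so $L_1=R_1$ is the $0\times 1$ matrix). A matrix pair $(M,N)$ \emph{gives} a pair of linear mappings if it consists of their matrices in some bases of the two spaces. Matrix pairs $(M,N)$ and $(M',N')$ are \emph{equivalent} if $SM=M'R$ and $SN=N'R$ for some nonsingular $S$ and $R$. A \emph{regularizing decomposition} of a matrix pair is a direct sum equivalent to it of the form $(I_r,D)\oplus(M_1,N_1)\oplus\dots\oplus(M_t,N_t)$, in which $D$ is a nonsingular $r\times r$ matrix and each $(M_i,N_i)$ is one of $(I_k,J_k(0))$, $(J_k(0),I_k)$, $(L_k,R_k)$, $(L_k^T,R_k^T)$, $k\ge1$. Define pairs of linear mappings $\mathcal P_{ij}=(\mathcal A_{ij},\mathcal B_{ij}):U_{ij}\to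 V_{ij}$, $i=1,2,3$, $j\ge 1$, by $\mathcal P_{11}=\mathcal P$, $\mathcal P_{21}=\mathcal P_{1\ell_1}$, $\mathcal P_{31}=\mathcal P_{2\ell_2}$ and \begin{align*} U_{1,j+1}&=\mathcal A_{1j}^{-1}(\operatorname{Im}\mathcal B_{1j}), & V_{1,j+1}&=\operatorname{Im}\mathcal B_{1j},\\ U_{2,j+1}&=\mathcal B_{2j}^{-1}(\operatorname{Im}\mathcal A_{2j}), & V_{2,j+1}&=\operatorname{Im}\mathcal A_{2j},\\ U_{3,j+1}&=U_{3j}/\operatorname{Ker}\mathcal B_{3j}, & V_{3,j+1}&=V_{3j}/\mathcal A_{3j}(\operatorname{Ker}\mathcal B_{3j}), \end{align*} where $\mathcal A_{i,j+1},\mathcal B_{i,j+1}$ are induced by $\mathcal A_{ij},\mathcal B_{ij}$, and where $\ell_1,\ell_2,\ell_3$ are the least $j\ge 1$ for which, respectively, $\mathcal B_{1j}$ is surjective, $\mathcal A_{2j}$ is surjective, $\mathcal B_{3j}$ is bijective. Then $\ell_1,\ell_2,\ell_3$ exist, and every matrix pair that gives $\mathcal P_{3\ell_3}$ is a pair of nonsingular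 matrices. For every such pair there exist bases of $U$ and $V$ in which $(\mathcal A,\mathcal B)$ is given by the direct sum of that pair and of \begin{itemize} \item $(\dim V_{1j}-\dim V_{1,j+1})-(\dim U_{1j}-\dim U_{1,j+1})$ copies of $(L_j^T,R_j^T)$, $1\le j<\ell_1$, \item $(\dim U_{1j}-\dim U_{1,j+1})-(\dim V_{1,j+1}-\dim V_{1,j+2})$ copies of $(I_j,J_j(0))$, $1\le j<\ell_1$, \item $\dim V_{2j}-2\dim V_{2,j+1}+\dim V_{2,j+2}$ copies of $(J_j(0),I_j)$, $1\le j<\ell_2$, \item $\dim U_{3j}-2\dim U_{3,j+1}+\dim U_{3,j+2}$ copies of $(L_j,R_j)$, $1\le j<\ell_3$ \end{itemize} (in particular, these numbers are nonnegative). The pair $\mathcal P_{3\ell_3}$ is given by some matrix pair of the form $(I_r,D)$, and, for every choice of $(I_r,D)$ giving $\mathcal P_{3\ell_3}$, the direct sum of $(I_r,D)$ and of the blocks listed above is a regularizing decomposition of each matrix pair that gives $\mathcal P$ in some bases of $U$ and $V$. -/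

import Mathlib

open Matrix

universe u v w

/-! ## Pairs of linear mappings and the three reductions -/

/-- A pair of linear mappings `A, B : U → V` between vector spaces over `F`. -/
structure LinearPair (F : Type w) [Field F] where
  U : Type u
  V : Type v
  [instACGU : AddCommGroup U]
  [instModU : Module F U]
  [instACGV : AddCommGroup V]
  [instModV : Module F V]
  A : U →ₗ[F] V
  B : U →ₗ[F] V

attribute [instance] LinearPair.instACGU LinearPair.instModU
  LinearPair.instACGV LinearPair.instModV

namespace LinearPair

variable {F : Type w} [Field F]

/-- `A, B : A⁻¹(im B) → im B`, the restrictions of `A` and `B`. -/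
def reduce₁ (P : LinearPair.{u, v, w} F) : LinearPair.{u, v, w} F where
  U := ↥((LinearMap.range P.B).comap P.A)
  V := ↥(LinearMap.range P.B)
  A := P.A.restrict (p := (LinearMap.range P.B).comap P.A) (q := LinearMap.range P.B)
    (fun _ hx => hx)
  B := P.B.restrict (p := (LinearMap.range P.B).comap P.A) (q := LinearMap.range P.B)
    (fun x _ => LinearMap.mem_range_self P.B x)

/-- `A, B : B⁻¹(im A) → im A`, the restrictions of `A` and `B`. -/
def reduce₂ (P : LinearPair.{u, v, w} F) : LinearPair.{u, v, w} F where
  U := ↥((LinearMap.range P.A).comap P.B)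
  V := ↥(LinearMap.range P.A)
  A := P.A.restrict (p := (LinearMap.range P.A).comap P.B) (q := LinearMap.range P.A)
    (fun x _ => LinearMap.mem_range_self P.A x)
  B := P.B.restrict (p := (LinearMap.range P.A).comap P.B) (q := LinearMap.range P.A)
    (fun _ hx => hx)

/-- `A, B : U / Ker B → V / A(Ker B)`, induced by `A` and `B`. -/
def reduce₃ (P : LinearPair.{u, v, w} F) : LinearPair.{u, v, w} F where
  U := P.U ⧸ LinearMap.ker P.B
  V := P.V ⧸ (LinearMap.ker P.B).map P.A
  A := Submodule.mapQ (LinearMap.ker P.B) ((LinearMap.ker P.B).map P.A) P.A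
    (Submodule.le_comap_map _ _)
  B := Submodule.mapQ (LinearMap.ker P.B) ((LinearMap.ker P.B).map P.A) P.B
    (fun x hx => by
      rw [Submodule.mem_comap, LinearMap.mem_ker.mp hx]
      exact Submodule.zero_mem _)

/-- `P_{1j}`, for `j ≥ 1`: `P_{11} = P` and `P_{1,j+1}` is the first reduction of `P_{1j}`. -/
def stage₁ (P : LinearPair.{u, v, w} F) (j : ℕ) : LinearPair.{u, v, w} F :=
  reduce₁^[j - 1] P

/-- `P_{2j}`, for `j ≥ 1`: `P_{21} = P_{1ℓ₁}` and `P_{2,j+1}` is the second reduction of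
`P_{2j}`. -/
def stage₂ (P : LinearPair.{u, v, w} F) (ℓ₁ j : ℕ) : LinearPair.{u, v, w} F :=
  reduce₂^[j - 1] (P.stage₁ ℓ₁)

/-- `P_{3j}`, for `j ≥ 1`: `P_{31} = P_{2ℓ₂}` and `P_{3,j+1}` is the third reduction of
`P_{3j}`. -/
def stage₃ (P : LinearPair.{u, v, w} F) (ℓ₁ ℓ₂ j : ℕ) : LinearPair.{u, v, w} F :=
  reduce₃^[j - 1] (P.stage₂ ℓ₁ ℓ₂)

/-- `dim U`, as an integer. -/
noncomputable def dimU (P : LinearPair.{u, v, w} F) : ℤ := (Module.finrank F P.U : ℤ)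

/-- `dim V`, as an integer. -/
noncomputable def dimV (P : LinearPair.{u, v, w} F) : ℤ := (Module.finrank F P.V : ℤ)

end LinearPair

/-! ## Matrix pairs -/

/-- A matrix over a field with possibly different index types for its rows and columns is
nonsingular if it has a two-sided inverse (so it has as many rows as columns). -/
def IsNonsingular {F : Type w} [Field F] {m n : Type} [Fintype m] [DecidableEq m]
    [Fintype n] [DecidableEq n] (S : Matrix m n F) : Prop :=
  ∃ T : Matrix n m F, S * T = 1 ∧ T * S = 1

/-- A pair of matrices of the same (finite) size over `F`. -/
structure MatrixPair (F : Type w) [Field F] where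
  rows : Type
  cols : Type
  [instFinR : Fintype rows]
  [instDecR : DecidableEq rows]
  [instFinC : Fintype cols]
  [instDecC : DecidableEq cols]
  fst : Matrix rows cols F
  snd : Matrix rows cols F

attribute [instance] MatrixPair.instFinR MatrixPair.instDecR
  MatrixPair.instFinC MatrixPair.instDecC

namespace MatrixPair

variable {F : Type w} [Field F]

/-- Equivalence of matrix pairs: `S A = A' R` and `S B = B' R` with `S`, `R` nonsingular. -/
def IsEquivalent (X Y : MatrixPair F) : Prop :=
  ∃ (S : Matrix Y.rows X.rows F) (R : Matrix Y.cols X.cols F),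
    IsNonsingular S ∧ IsNonsingular R ∧ S * X.fst = Y.fst * R ∧ S * X.snd = Y.snd * R

/-- The direct sum of two matrix pairs. -/
def oplus (X Y : MatrixPair F) : MatrixPair F where
  rows := X.rows ⊕ Y.rows
  cols := X.cols ⊕ Y.cols
  fst := Matrix.fromBlocks X.fst 0 0 Y.fst
  snd := Matrix.fromBlocks X.snd 0 0 Y.snd

/-- The direct sum of a finite family of matrix pairs. -/
def directSum {ι : Type} [Fintype ι] [DecidableEq ι] (X : ι → MatrixPair F) :
    MatrixPair F where
  rows := Σ i, (X i).rows
  cols := Σ i, (X i).cols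
  fst := Matrix.blockDiagonal' fun i => (X i).fst
  snd := Matrix.blockDiagonal' fun i => (X i).snd

/-- The matrix pair `(I_r, D)`. -/
def idPair {r : ℕ} (D : Matrix (Fin r) (Fin r) F) : MatrixPair F where
  rows := Fin r
  cols := Fin r
  fst := 1
  snd := D

end MatrixPair

/-- The matrix pair `X` gives the pair of linear mappings `P` in some bases of `U` and `V`. -/
def LinearPair.IsGivenBy {F : Type w} [Field F] (P : LinearPair.{u, v, w} F)
    (X : MatrixPair F) : Prop :=
  ∃ (b : Module.Basis X.cols F P.U) (c : Module.Basis X.rows F P.V),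
    LinearMap.toMatrix b c P.A = X.fst ∧ LinearMap.toMatrix b c P.B = X.snd

/-! ## The singular blocks -/

/-- The `k × k` singular Jordan block with units under the diagonal. -/
def jordanZero (F : Type w) [Field F] (k : ℕ) : Matrix (Fin k) (Fin k) F :=
  Matrix.of fun i j => if (i : ℕ) = (j : ℕ) + 1 then 1 else 0

/-- `L_k`: the identity matrix `I_k` without its last row (`k ≥ 1`). -/
def matL (F : Type w) [Field F] (k : ℕ) : Matrix (Fin (k - 1)) (Fin k) F :=
  Matrix.of fun i j => if (j : ℕ) = (i : ℕ) then 1 else 0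

/-- `R_k`: the identity matrix `I_k` without its first row (`k ≥ 1`). -/
def matR (F : Type w) [Field F] (k : ℕ) : Matrix (Fin (k - 1)) (Fin k) F :=
  Matrix.of fun i j => if (j : ℕ) = (i : ℕ) + 1 then 1 else 0

/-- The four types of singular blocks: `(I_k, J_k(0))`, `(J_k(0), I_k)`, `(L_k, R_k)` and
`(L_kᵀ, R_kᵀ)`. -/
inductive BlockKind : Type
  | IJ
  | JI
  | LR
  | LRT

instance BlockKind.instDecidableEq : DecidableEq BlockKind := fun a b => by
  cases a <;> cases b <;>
    first
      | exact isTrue rfl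
      | exact isFalse (by intro h; cases h)

instance BlockKind.instFintype : Fintype BlockKind where
  elems := {BlockKind.IJ, BlockKind.JI, BlockKind.LR, BlockKind.LRT}
  complete := by intro x; cases x <;> simp

/-- The singular block of a given type and size parameter `k ≥ 1`. -/
def singularBlock (F : Type w) [Field F] : BlockKind → ℕ → MatrixPair F
  | .IJ, k => { rows := Fin k, cols := Fin k, fst := 1, snd := jordanZero F k }
  | .JI, k => { rows := Fin k, cols := Fin k, fst := jordanZero F k, snd := 1 }
  | .LR, k => { rows := Fin (k - 1), cols := Fin k, fst := matL F k, snd := matR F k }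
  | .LRT, k =>
      { rows := Fin k, cols := Fin (k - 1), fst := (matL F k)ᵀ, snd := (matR F k)ᵀ }

/-- The direct sum of `(I_r, D)` and the matrix pairs `S i` is a regularizing decomposition of
the matrix pair `X`: `D` is nonsingular, every `S i` is a singular block, and `X` is equivalent
to the direct sum. -/
def MatrixPair.IsRegularizingDecomposition {F : Type w} [Field F] (X : MatrixPair F) {r : ℕ}
    (D : Matrix (Fin r) (Fin r) F) {ι : Type} [Fintype ι] [DecidableEq ι]
    (S : ι → MatrixPair F) : Prop :=
  IsNonsingular D ∧
  (∀ i, ∃ (s : BlockKind) (k : ℕ), 1 ≤ k ∧ S i = singularBlock F s k) ∧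
  X.IsEquivalent ((MatrixPair.idPair D).oplus (MatrixPair.directSum S))

/-- The exclusive upper bound for the sizes of the blocks of each type. -/
def sizeBound (ℓ₁ ℓ₂ ℓ₃ : ℕ) : BlockKind → ℕ
  | .LRT => ℓ₁
  | .IJ => ℓ₁
  | .JI => ℓ₂
  | .LR => ℓ₃

/-- An index set with `μ s j` elements for each block type `s` and each size `1 ≤ j < ℓ s`. -/
abbrev BlockIndex (ℓ : BlockKind → ℕ) (μ : BlockKind → ℕ → ℕ) : Type :=
  Σ s : BlockKind, Σ j : Finset.Ico 1 (ℓ s), Fin (μ s j)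

/-- The family with `μ s j` copies of the singular block of type `s` and size `j`, for each
block type `s` and each `1 ≤ j < ℓ s`. -/
def blockFamily (F : Type w) [Field F] (ℓ : BlockKind → ℕ) (μ : BlockKind → ℕ → ℕ) :
    BlockIndex ℓ μ → MatrixPair F :=
  fun x => singularBlock F x.1 x.2.1

-- Everything rests on undoing one first reduction. Suppose the pair induced on A⁻¹(im B) → im B is
-- the direct sum of a matrix pair X on which B is onto and of chains: A sends the n-th vector of a
-- chain to the n-th one, and B sends it to the next one or to 0. Pull each chain head back along B
-- to some y, and take A y as a new head; every chain then grows by one. New chains of length one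
-- come from two sources: vectors z of Ker B completing A⁻¹(im B) to A⁻¹(im B) + Ker B give chains z
-- ↦ A z, and vectors t of V completing im B + im A give chains without source vectors. The enlarged
-- families span, and a dimension count makes them bases (`HasChains.of_reduce₁`).
--
-- The chain heads form a basis of V modulo im B, so the number of chains is determined by
-- dimensions, and hence so are the numbers of z's and t's. Chains with k source and k target
-- vectors are the blocks (I_k, J_k(0)); those with k - 1 source vectors are (L_kᵀ, R_kᵀ). Induction
-- gives all multiplicities for the first reduction (`exists_hasChains`).
--
-- The other two reductions are the first one in disguise. The second is the first after
-- interchanging A and B; there B is already onto, which excludes the blocks (L_kᵀ, R_kᵀ). The third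
-- is the first for the dual pair; there the dual of B is injective, which excludes (I_k, J_k(0)),
-- and transposing turns (L_kᵀ, R_kᵀ) into (L_k, R_k). Surjectivity survives the later reductions,
-- so A and B are both bijective on the last pair. Its matrices are then lifted back through the
-- three reductions in reverse order.

universe u' v' u'' v''

namespace LinearPair

/-! ### Complements and dimension counts -/

/-- A submodule generated by elements of `K` that complements `N` in `N ⊔ K`, with a
generating family whose length is the codimension. -/
theorem exists_complementing_family {F : Type*} {M : Type*} [Field F] [AddCommGroup M]
    [Module F M] [FiniteDimensional F M] (N K : Submodule F M) :
    ∃ (a : ℕ) (x : Fin a → M), (∀ i, x i ∈ K) ∧ N ⊔ Submodule.span F (Set.range x) = N ⊔ K ∧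
      a + Module.finrank F N = Module.finrank F ↥(N ⊔ K) := by
  -- Lift to `K` a basis of the image of `K` in `M ⧸ N`.
  set S := K.map N.mkQ with hS
  let e := Module.finBasis F S
  have hx : ∀ i, ∃ y ∈ K, N.mkQ y = (e i : M ⧸ N) := fun i => (e i).2
  choose x hxK hx using hx
  refine ⟨Module.finrank F S, x, hxK, ?_, ?_⟩
  · have h : S = (Submodule.span F (Set.range x)).map N.mkQ := by
      rw [Submodule.map_span, ← Set.range_comp]
      have h1 : (N.mkQ ∘ x) = S.subtype ∘ e := funext hx
      rw [h1, Set.range_comp, ← Submodule.map_span, e.span_eq, Submodule.map_top,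
        Submodule.range_subtype]
    rw [← Submodule.comap_map_mkQ, ← Submodule.comap_map_mkQ, ← h]
  · have h := LinearMap.finrank_range_add_finrank_ker (N.mkQ.domRestrict (N ⊔ K))
    have h1 : LinearMap.range (N.mkQ.domRestrict (N ⊔ K)) = S := by
      rw [LinearMap.range_domRestrict, Submodule.map_sup]
      simp [hS, Submodule.mkQ_map_self]
    have h2 : LinearMap.ker (N.mkQ.domRestrict (N ⊔ K)) = N.comap (N ⊔ K).subtype := by
      ext y; simp
    rw [h1, h2, (Submodule.comapSubtypeEquivOfLe (le_sup_left : N ≤ N ⊔ K)).finrank_eq] at h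
    exact h

/-- The maps `M → N ⧸ W` and `W ⊔ range f → N ⧸ W` have the same range, and their kernels are
`W.comap f` and `W`; apply rank-nullity to both. -/
theorem finrank_comap_add_finrank_sup_range {F : Type*} {M N : Type*} [Field F] [AddCommGroup M]
    [Module F M] [FiniteDimensional F M] [AddCommGroup N]
    [Module F N] [FiniteDimensional F N] (f : M →ₗ[F] N) (W : Submodule F N) :
    Module.finrank F ↥(W.comap f) + Module.finrank F ↥(W ⊔ LinearMap.range f) =
      Module.finrank F M + Module.finrank F W := by
  have h1 := LinearMap.finrank_range_add_finrank_ker (W.mkQ.comp f)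
  have h2 := LinearMap.finrank_range_add_finrank_ker (W.mkQ.domRestrict (W ⊔ LinearMap.range f))
  have h3 : LinearMap.range (W.mkQ.domRestrict (W ⊔ LinearMap.range f)) =
      LinearMap.range (W.mkQ.comp f) := by
    rw [LinearMap.range_domRestrict, Submodule.map_sup, LinearMap.range_comp]
    simp [Submodule.mkQ_map_self]
  have h4 : LinearMap.ker (W.mkQ.domRestrict (W ⊔ LinearMap.range f)) =
      W.comap (W ⊔ LinearMap.range f).subtype := by
    ext y; simp
  have h5 : LinearMap.ker (W.mkQ.comp f) = W.comap f := by
    rw [LinearMap.ker_comp, Submodule.ker_mkQ]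
  rw [h3, h4, (Submodule.comapSubtypeEquivOfLe (le_sup_left : W ≤ _)).finrank_eq] at h2
  rw [h5] at h1
  omega

/-! ### Chains, and their extension through one first reduction -/

variable {F : Type w} [Field F]

instance reduce₁_finite_U (P : LinearPair.{u, v, w} F) [FiniteDimensional F P.U] :
    FiniteDimensional F P.reduce₁.U :=
  inferInstanceAs (FiniteDimensional F ↥((LinearMap.range P.B).comap P.A))

instance reduce₁_finite_V (P : LinearPair.{u, v, w} F) [FiniteDimensional F P.U] :
    FiniteDimensional F P.reduce₁.V :=
  inferInstanceAs (FiniteDimensional F ↥(LinearMap.range P.B))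

/-- The inclusion `A⁻¹(im B) → U`. -/
def inclU (P : LinearPair.{u, v, w} F) : P.reduce₁.U →ₗ[F] P.U :=
  ((LinearMap.range P.B).comap P.A).subtype

/-- The inclusion `im B → V`. -/
def inclV (P : LinearPair.{u, v, w} F) : P.reduce₁.V →ₗ[F] P.V :=
  (LinearMap.range P.B).subtype

variable (P : LinearPair.{u, v, w} F)

theorem range_inclU : LinearMap.range P.inclU = (LinearMap.range P.B).comap P.A :=
  Submodule.range_subtype _

theorem range_inclV : LinearMap.range P.inclV = LinearMap.range P.B :=
  Submodule.range_subtype _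

theorem inclV_injective : Function.Injective P.inclV :=
  Submodule.subtype_injective _

/-- `B` as a surjection `U → im B`. -/
def toRangeB : P.U →ₗ[F] P.reduce₁.V := P.B.rangeRestrict

theorem inclV_toRangeB (x : P.U) : P.inclV (P.toRangeB x) = P.B x := rfl

theorem toRangeB_surjective : Function.Surjective P.toRangeB :=
  LinearMap.surjective_rangeRestrict _

variable {P}

/-- Bases of `U` and `V` in which the pair is the direct sum of the matrix pair `X` and of
chains: in the `i`-th chain `A` sends the `n`-th vector to the `n`-th one and `B` sends it to
the next one. -/
structure IsChainBasis (P : LinearPair.{u, v, w} F) (X : MatrixPair F) {ι : Type} (p q : ι → ℕ)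
    (b : Module.Basis (X.cols ⊕ Σ i, Fin (q i)) F P.U)
    (c : Module.Basis (X.rows ⊕ Σ i, Fin (p i)) F P.V) : Prop where
  A_inl : ∀ j, P.A (b (.inl j)) = ∑ i, X.fst i j • c (.inl i)
  B_inl : ∀ j, P.B (b (.inl j)) = ∑ i, X.snd i j • c (.inl i)
  A_inr : ∀ i n (h : n < p i) (h' : n < q i), P.A (b (.inr ⟨i, n, h'⟩)) = c (.inr ⟨i, n, h⟩)
  B_inr : ∀ i n (h : n + 1 < p i) (h' : n < q i),
    P.B (b (.inr ⟨i, n, h'⟩)) = c (.inr ⟨i, n + 1, h⟩)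
  B_last : ∀ i n (h' : n < q i), p i ≤ n + 1 → P.B (b (.inr ⟨i, n, h'⟩)) = 0

namespace IsChainBasis

variable {X : MatrixPair F} {ι : Type} [Fintype ι] {p q : ι → ℕ}
    {b : Module.Basis (X.cols ⊕ Σ i, Fin (q i)) F P.U}
    {c : Module.Basis (X.rows ⊕ Σ i, Fin (p i)) F P.V}

/-- The coordinates at the first vectors of the chains. -/
noncomputable def headCoord (c : Module.Basis (X.rows ⊕ Σ i, Fin (p i)) F P.V)
    (hp : ∀ i, 0 < p i) : P.V →ₗ[F] (ι → F) :=
  (LinearMap.funLeft F F fun i => (Sum.inr ⟨i, 0, hp i⟩ : X.rows ⊕ Σ i, Fin (p i))).comp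
    c.equivFun.toLinearMap

theorem headCoord_apply (hp : ∀ i, 0 < p i) (x : P.V) (i : ι) :
    headCoord c hp x i = c.repr x (.inr ⟨i, 0, hp i⟩) := rfl

theorem headCoord_surjective (hp : ∀ i, 0 < p i) : Function.Surjective (headCoord c hp) := by
  have h : Function.Injective fun i =>
      (Sum.inr ⟨i, 0, hp i⟩ : X.rows ⊕ Σ i, Fin (p i)) := by
    intro i j h
    exact congrArg Sigma.fst (Sum.inr.inj h)
  exact (LinearMap.funLeft_surjective_of_injective F F _ h).comp c.equivFun.surjective

/-- `B` never produces a head component. Conversely, `p i ≤ q i + 1` makes every later chain vector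
the image of its predecessor, and the right inverse of `X.snd` puts the part spanned by `X` into the
image. -/
theorem ker_headCoord (h : IsChainBasis P X p q b c) (hp : ∀ i, 0 < p i)
    (hpq : ∀ i, p i ≤ q i + 1) (hX : ∃ T : Matrix X.cols X.rows F, X.snd * T = 1) :
    LinearMap.ker (headCoord c hp) = LinearMap.range P.B := by
  classical
  apply le_antisymm
  · intro x hx
    have hx' : ∀ i, c.repr x (.inr ⟨i, 0, hp i⟩) = 0 := fun i => congrFun hx i
    rw [← c.sum_repr x]
    refine Submodule.sum_mem _ ?_
    rintro (r | ⟨i, n, hn⟩) -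
    · refine Submodule.smul_mem _ _ ?_
      obtain ⟨T, hT⟩ := hX
      -- Column `r` of the right inverse is the coordinate vector of a preimage.
      refine ⟨∑ j, T j r • b (.inl j), ?_⟩
      simp_rw [map_sum, map_smul, h.B_inl, Finset.smul_sum, smul_smul]
      rw [Finset.sum_comm]
      simp_rw [← Finset.sum_smul]
      have h1 : ∀ i, ∑ j, T j r * X.snd i j = (1 : Matrix X.rows X.rows F) i r := by
        intro i
        rw [← hT, Matrix.mul_apply]
        exact Finset.sum_congr rfl fun _ _ => mul_comm _ _
      simp [h1, Matrix.one_apply]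
    · rcases n with _ | n
      · rw [hx' i, zero_smul]; exact Submodule.zero_mem _
      · refine Submodule.smul_mem _ _ ?_
        have := hpq i
        exact ⟨_, h.B_inr i n hn (by omega)⟩
  · rintro _ ⟨y, rfl⟩
    have : (headCoord c hp).comp P.B = 0 := by
      refine b.ext ?_
      rintro (j | ⟨i, n, hn⟩) <;> ext k <;>
        simp only [LinearMap.comp_apply, LinearMap.zero_apply, Pi.zero_apply]
      · rw [h.B_inl, headCoord_apply]
        simp [map_sum]
      · by_cases hn' : n + 1 < p i
        · rw [h.B_inr i n hn' hn, headCoord_apply, Module.Basis.repr_self,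
            Finsupp.single_eq_of_ne]
          intro h1
          rw [Sum.inr.injEq, Sigma.mk.injEq] at h1
          obtain ⟨rfl, h1⟩ := h1
          simp at h1
        · rw [h.B_last i n hn (by omega)]; simp
    exact LinearMap.congr_fun this y

/-- The heads are a basis modulo im B, so the number of chains depends only on the pair. This is the
source of the multiplicity formulas. -/
theorem card_add_finrank [FiniteDimensional F P.V]
    (h : IsChainBasis P X p q b c) (hp : ∀ i, 0 < p i)
    (hpq : ∀ i, p i ≤ q i + 1) (hX : ∃ T : Matrix X.cols X.rows F, X.snd * T = 1) :
    Fintype.card ι + Module.finrank F (LinearMap.range P.B) = Module.finrank F P.V := by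
  have h1 := LinearMap.finrank_range_add_finrank_ker (headCoord c hp)
  rwa [LinearMap.range_eq_top.2 (headCoord_surjective hp), finrank_top,
    Module.finrank_fintype_fun_eq_card, h.ker_headCoord hp hpq hX] at h1

theorem exists_sub_mem_range (h : IsChainBasis P X p q b c) (hp : ∀ i, 0 < p i)
    (hpq : ∀ i, p i ≤ q i + 1) (hX : ∃ T : Matrix X.cols X.rows F, X.snd * T = 1) (x : P.V) :
    ∃ g : ι → F, x - ∑ i, g i • c (.inr ⟨i, 0, hp i⟩) ∈ LinearMap.range P.B := by
  classical
  refine ⟨headCoord c hp x, ?_⟩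
  rw [← h.ker_headCoord hp hpq hX, LinearMap.mem_ker, map_sub, sub_eq_zero]
  ext k
  simp only [headCoord_apply, map_sum, map_smul, Module.Basis.repr_self, Finsupp.coe_finsetSum,
    Finset.sum_apply, Finsupp.smul_apply]
  rw [Finset.sum_eq_single k]
  · simp
  · intro i _ hi
    rw [Finsupp.single_eq_of_ne, smul_zero]
    intro h1
    rw [Sum.inr.injEq, Sigma.mk.injEq] at h1
    exact hi h1.1.symm
  · simp

end IsChainBasis

/-- The pair is given by the direct sum of `X` and of chains of the given lengths. -/
def HasChains (P : LinearPair.{u, v, w} F) (X : MatrixPair F) {ι : Type} (p q : ι → ℕ) : Prop :=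
  ∃ b c, IsChainBasis P X p q b c

/-- The chains of `reduce₁ P` extend to chains of `P`, longer by one. -/
theorem HasChains.of_reduce₁ [FiniteDimensional F P.U] [FiniteDimensional F P.V]
    {X : MatrixPair F} {ι : Type} [Fintype ι] {p q : ι → ℕ} (h : HasChains P.reduce₁ X p q)
    (hp : ∀ i, 0 < p i) (hpq : ∀ i, p i ≤ q i + 1) (hX : ∃ T : Matrix X.cols X.rows F, X.snd * T = 1) :
    ∃ m n : ℕ,
      Fintype.card ι + Module.finrank F P.reduce₁.reduce₁.V = Module.finrank F P.reduce₁.V ∧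
      Fintype.card ι + m + Module.finrank F P.reduce₁.U = Module.finrank F P.U ∧
      Fintype.card ι + m + n + Module.finrank F P.reduce₁.V = Module.finrank F P.V ∧
      HasChains P X (ι := ι ⊕ (Fin m ⊕ Fin n)) (Sum.elim (fun i => p i + 1) fun _ => 1)
        (Sum.elim (fun i => q i + 1) (Sum.elim (fun _ => 1) fun _ => 0)) := by
  classical
  obtain ⟨b, c, h⟩ := h
  have hcard := h.card_add_finrank hp hpq hX
  -- preimages of the first vectors of the chains
  choose y hy using fun i : ι => P.toRangeB_surjective (c (.inr ⟨i, 0, hp i⟩))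
  -- Each `z i` starts a chain with one source and one target vector, since `B` kills it; each `t i`
  -- below is a chain with a target vector only.
  obtain ⟨m, z, hzK, hz, hm⟩ :=
    exists_complementing_family ((LinearMap.range P.B).comap P.A) (LinearMap.ker P.B)
  obtain ⟨n, t, -, ht, hn⟩ :=
    exists_complementing_family (LinearMap.range P.B ⊔ LinearMap.range P.A) ⊤
  have hU' : Module.finrank F P.reduce₁.U =
    Module.finrank F ↥((LinearMap.range P.B).comap P.A) := rfl
  have hV' : Module.finrank F P.reduce₁.V = Module.finrank F (LinearMap.range P.B) := rfl
  -- If B x = B x' with x' in A⁻¹(im B), then x - x' lies in Ker B. These x are the ones reached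
  -- without the preimages `y i`.
  have hcomap : ((LinearMap.range P.reduce₁.B).comap P.toRangeB) =
      (LinearMap.range P.B).comap P.A ⊔ LinearMap.ker P.B := by
    ext x
    rw [Submodule.mem_comap, LinearMap.mem_range, Submodule.mem_sup]
    constructor
    · rintro ⟨x', hx'⟩
      have h1 : P.B (P.inclU x') = P.B x := congrArg P.inclV hx'
      exact ⟨P.inclU x', x'.2, x - P.inclU x', by simp [h1], by simp⟩
    · rintro ⟨x', hx', k, hk, rfl⟩
      refine ⟨⟨x', hx'⟩, P.inclV_injective ?_⟩
      rw [inclV_toRangeB, map_add, LinearMap.mem_ker.1 hk, add_zero]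
      rfl
  have hUdim : Fintype.card ι + m + Module.finrank F P.reduce₁.U = Module.finrank F P.U := by
    have h1 := finrank_comap_add_finrank_sup_range P.toRangeB (LinearMap.range P.reduce₁.B)
    rw [hcomap, LinearMap.range_eq_top.2 P.toRangeB_surjective, sup_top_eq, finrank_top] at h1
    omega
  have hVdim : Fintype.card ι + m + n + Module.finrank F P.reduce₁.V = Module.finrank F P.V := by
    have h1 := finrank_comap_add_finrank_sup_range P.A (LinearMap.range P.B)
    rw [sup_top_eq, finrank_top] at hn
    omega
  refine ⟨m, n, hcard, hUdim, hVdim, ?_⟩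
  let q' : ι ⊕ (Fin m ⊕ Fin n) → ℕ :=
    Sum.elim (fun i => q i + 1) (Sum.elim (fun _ => 1) fun _ => 0)
  let p' : ι ⊕ (Fin m ⊕ Fin n) → ℕ := Sum.elim (fun i => p i + 1) fun _ => 1
  let β : X.cols ⊕ (Σ i, Fin (q' i)) → P.U := Sum.elim (fun j => P.inclU (b (.inl j)))
    (fun x => match x with
      | ⟨.inl i, k⟩ => Fin.cons (α := fun _ => P.U) (y i) (fun k => P.inclU (b (.inr ⟨i, k⟩))) k
      | ⟨.inr (.inl i), _⟩ => z i
      | ⟨.inr (.inr _), k⟩ => k.elim0)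
  let γ : X.rows ⊕ (Σ i, Fin (p' i)) → P.V := Sum.elim (fun j => P.inclV (c (.inl j)))
    (fun x => match x with
      | ⟨.inl i, k⟩ => Fin.cons (α := fun _ => P.V) (P.A (y i))
          (fun k => P.inclV (c (.inr ⟨i, k⟩))) k
      | ⟨.inr (.inl i), _⟩ => P.A (z i)
      | ⟨.inr (.inr i), _⟩ => t i)
  have hβU' : (LinearMap.range P.B).comap P.A ≤ Submodule.span F (Set.range β) := by
    rw [← P.range_inclU, LinearMap.range_eq_map, ← b.span_eq, Submodule.map_span,
      Submodule.span_le]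
    rintro _ ⟨_, ⟨j | ⟨i, k, hk⟩, rfl⟩, rfl⟩
    · exact Submodule.subset_span ⟨.inl j, rfl⟩
    · exact Submodule.subset_span ⟨.inr ⟨.inl i, k + 1, Nat.succ_lt_succ hk⟩, rfl⟩
  have hyβ : ∀ i, y i ∈ Submodule.span F (Set.range β) := fun i =>
    Submodule.subset_span ⟨.inr ⟨.inl i, 0, Nat.succ_pos _⟩, rfl⟩
  have hker : LinearMap.ker P.B ≤ Submodule.span F (Set.range β) := by
    have h1 : (LinearMap.range P.B).comap P.A ⊔ Submodule.span F (Set.range z) ≤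
        Submodule.span F (Set.range β) := by
      refine sup_le hβU' ?_
      rw [Submodule.span_le]
      rintro _ ⟨i, rfl⟩
      exact Submodule.subset_span ⟨.inr ⟨.inr (.inl i), 0, Nat.one_pos⟩, rfl⟩
    rw [hz] at h1
    exact le_sup_right.trans h1
  -- Modulo the image of the reduced `B`, the vector B x is a combination of heads B (y i);
  -- subtracting the same combination of the `y i` from x lands in A⁻¹(im B) + Ker B.
  have hβ : ⊤ ≤ Submodule.span F (Set.range β) := by
    intro x _
    obtain ⟨g, hg⟩ := h.exists_sub_mem_range hp hpq hX (P.toRangeB x)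
    have h1 : x - ∑ i, g i • y i ∈ (LinearMap.range P.reduce₁.B).comap P.toRangeB := by
      rw [Submodule.mem_comap]
      simpa [hy] using hg
    rw [hcomap] at h1
    have h2 := sup_le hβU' hker h1
    have h3 : ∑ i, g i • y i ∈ Submodule.span F (Set.range β) :=
      Submodule.sum_mem _ fun i _ => Submodule.smul_mem _ _ (hyβ i)
    simpa using add_mem h2 h3
  have hγV' : LinearMap.range P.B ≤ Submodule.span F (Set.range γ) := by
    rw [← P.range_inclV, LinearMap.range_eq_map, ← c.span_eq, Submodule.map_span,
      Submodule.span_le]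
    rintro _ ⟨_, ⟨j | ⟨i, k, hk⟩, rfl⟩, rfl⟩
    · exact Submodule.subset_span ⟨.inl j, rfl⟩
    · exact Submodule.subset_span ⟨.inr ⟨.inl i, k + 1, Nat.succ_lt_succ hk⟩, rfl⟩
  have hγA : LinearMap.range P.A ≤ Submodule.span F (Set.range γ) := by
    rw [LinearMap.range_eq_map, ← top_le_iff.1 hβ, Submodule.map_span, Submodule.span_le]
    have h0 : ∀ x : P.reduce₁.U, P.A (P.inclU x) ∈ Submodule.span F (Set.range γ) :=
      fun x => hγV' x.2
    rintro _ ⟨_, ⟨j | ⟨i | i | i, k, hk⟩, rfl⟩, rfl⟩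
    · exact h0 _
    · rcases k with _ | k
      · exact Submodule.subset_span ⟨.inr ⟨.inl i, 0, Nat.succ_pos _⟩, rfl⟩
      · exact h0 _
    · exact Submodule.subset_span ⟨.inr ⟨.inr (.inl i), 0, Nat.one_pos⟩, rfl⟩
    · exact absurd hk (Nat.not_lt_zero _)
  have hγ : ⊤ ≤ Submodule.span F (Set.range γ) := by
    rw [sup_top_eq] at ht
    rw [← ht]
    refine sup_le (sup_le hγV' hγA) ?_
    rw [Submodule.span_le]
    rintro _ ⟨i, rfl⟩
    exact Submodule.subset_span ⟨.inr ⟨.inr (.inr i), 0, Nat.one_pos⟩, rfl⟩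
  -- Linear independence is never checked directly: a spanning family with as many members as the
  -- dimension is a basis.
  have hβcard : Fintype.card (X.cols ⊕ (Σ i, Fin (q' i))) = Module.finrank F P.U := by
    have h1 := Module.finrank_eq_card_basis b
    simp only [Fintype.card_sum, Fintype.card_sigma, Fintype.card_fin] at h1
    simp only [Fintype.card_sum, Fintype.card_sigma, Fintype.card_fin, Fintype.sum_sum_type, q',
      Sum.elim_inl, Sum.elim_inr, Finset.sum_add_distrib, Finset.sum_const, Finset.card_univ,
      smul_eq_mul]
    omega
  have hγcard : Fintype.card (X.rows ⊕ (Σ i, Fin (p' i))) = Module.finrank F P.V := by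
    have h1 := Module.finrank_eq_card_basis c
    simp only [Fintype.card_sum, Fintype.card_sigma, Fintype.card_fin] at h1
    simp only [Fintype.card_sum, Fintype.card_sigma, Fintype.card_fin, Fintype.sum_sum_type, p',
      Sum.elim_inl, Sum.elim_inr, Finset.sum_add_distrib, Finset.sum_const, Finset.card_univ,
      smul_eq_mul]
    omega
  refine ⟨basisOfTopLeSpanOfCardEqFinrank β hβ hβcard,
    basisOfTopLeSpanOfCardEqFinrank γ hγ hγcard, ?_, ?_, ?_, ?_, ?_⟩ <;>
    simp only [coe_basisOfTopLeSpanOfCardEqFinrank]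
  · intro j
    have := congrArg P.inclV (h.A_inl j)
    simp only [map_sum, map_smul] at this
    exact this
  · intro j
    have := congrArg P.inclV (h.B_inl j)
    simp only [map_sum, map_smul] at this
    exact this
  · rintro (i | i | i) k hk hk'
    · rcases k with _ | k
      · rfl
      · exact congrArg P.inclV (h.A_inr i k (Nat.lt_of_succ_lt_succ hk)
          (Nat.lt_of_succ_lt_succ hk'))
    · rfl
    · exact absurd hk' (Nat.not_lt_zero _)
  · rintro (i | i | i) k hk hk'
    · rcases k with _ | k
      · exact congrArg P.inclV (hy i)
      · exact congrArg P.inclV (h.B_inr i k (Nat.lt_of_succ_lt_succ hk)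
          (Nat.lt_of_succ_lt_succ hk'))
    · exact absurd hk (by simp)
    · exact absurd hk' (Nat.not_lt_zero _)
  · rintro (i | i | i) k hk' hk
    · have := hp i
      rcases k with _ | k
      · simp only [Sum.elim_inl] at hk; omega
      · exact congrArg P.inclV (h.B_last i k (Nat.lt_of_succ_lt_succ hk')
          (Nat.le_of_succ_le_succ hk))
    · exact hzK i
    · exact absurd hk' (Nat.not_lt_zero _)

end LinearPair

/-! ### Counting chains through iterated first reductions, and their matrices -/

namespace LinearPair
variable {F : Type w} [Field F]

/-- The number of blocks `(L_kᵀ, R_kᵀ)` for `k = n + 1`. -/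
noncomputable def countLRT (P : LinearPair.{u, v, w} F) (n : ℕ) : ℤ :=
  ((reduce₁^[n] P).dimV - (reduce₁^[n + 1] P).dimV)
    - ((reduce₁^[n] P).dimU - (reduce₁^[n + 1] P).dimU)

/-- The number of blocks `(I_k, J_k(0))` for `k = n + 1`. -/
noncomputable def countIJ (P : LinearPair.{u, v, w} F) (n : ℕ) : ℤ :=
  ((reduce₁^[n] P).dimU - (reduce₁^[n + 1] P).dimU)
    - ((reduce₁^[n + 1] P).dimV - (reduce₁^[n + 2] P).dimV)

theorem IsGivenBy.apply_eq {P : LinearPair.{u, v, w} F} {X : MatrixPair F}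
    {b : Module.Basis X.cols F P.U} {c : Module.Basis X.rows F P.V} {A : P.U →ₗ[F] P.V}
    {M : Matrix X.rows X.cols F} (h : LinearMap.toMatrix b c A = M) (j : X.cols) :
    A (b j) = ∑ i, M i j • c i := by
  subst h
  conv_lhs => rw [← c.sum_repr (A (b j))]
  simp [LinearMap.toMatrix_apply]

theorem isGivenBy_of_apply {P : LinearPair.{u, v, w} F} {X : MatrixPair F}
    (b : Module.Basis X.cols F P.U) (c : Module.Basis X.rows F P.V)
    (hA : ∀ j, P.A (b j) = ∑ i, X.fst i j • c i) (hB : ∀ j, P.B (b j) = ∑ i, X.snd i j • c i) :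
    P.IsGivenBy X := by
  refine ⟨b, c, ?_, ?_⟩ <;> ext i j
  · simp [LinearMap.toMatrix_apply, hA, Finsupp.single_apply]
  · simp [LinearMap.toMatrix_apply, hB, Finsupp.single_apply]

theorem IsGivenBy.hasChains {P : LinearPair.{u, v, w} F} {X : MatrixPair F}
    (h : P.IsGivenBy X) : HasChains P X (ι := Empty) (fun _ => 0) (fun _ => 0) := by
  obtain ⟨b, c, hA, hB⟩ := h
  refine ⟨b.reindex (Equiv.sumEmpty _ _).symm, c.reindex (Equiv.sumEmpty _ _).symm,
    ?_, ?_, ?_, ?_, ?_⟩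
  · intro j
    simpa using IsGivenBy.apply_eq hA j
  · intro j
    simpa using IsGivenBy.apply_eq hB j
  all_goals exact fun i => i.elim

/-- Induction peeling off the outermost reduction: old chains shift from length k to k + 1, as do
their counts, and the chains of length 1 are exactly the newly created ones. -/
theorem exists_hasChains (n : ℕ) (P : LinearPair.{u, v, w} F) [FiniteDimensional F P.U]
    [FiniteDimensional F P.V] (X : MatrixPair F)
    (hX : ∃ T : Matrix X.cols X.rows F, X.snd * T = 1) (h : (reduce₁^[n] P).IsGivenBy X) :
    ∃ (ι : Type) (_ : Fintype ι) (p q : ι → ℕ),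
      (∀ i, 0 < p i ∧ p i ≤ n ∧ (q i = p i ∨ q i + 1 = p i)) ∧
      (∀ k < n, ((Finset.univ.filter fun i => p i = k + 1 ∧ q i = k).card : ℤ) =
        P.countLRT k) ∧
      (∀ k < n, ((Finset.univ.filter fun i => p i = k + 1 ∧ q i = k + 1).card : ℤ) =
        P.countIJ k) ∧
      HasChains P X p q := by
  induction n generalizing P with
  | zero =>
    exact ⟨Empty, inferInstance, _, _, fun i => i.elim, by simp, by simp, h.hasChains⟩
  | succ n ih =>
    obtain ⟨ι, _, p, q, hpq, h1, h2, h3⟩ := ih P.reduce₁ h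
    obtain ⟨a, b, hV, hU, hV', hc⟩ := h3.of_reduce₁ (fun i => (hpq i).1)
      (fun i => by have := (hpq i).2.2; omega) hX
    refine ⟨_, inferInstance, _, _, ?_, ?_, ?_, hc⟩
    · rintro (i | i | i) <;> simp
      exact (hpq i).2
    · rintro (_ | k) hk
      -- An extended old chain has length at least 2, so it does not enter the count for length 1.
      · have h0 : ∀ i, p i ≠ 0 := fun i => (hpq i).1.ne'
        have h4 : P.countLRT 0 =
          ((Module.finrank F P.V : ℤ) - (Module.finrank F P.reduce₁.V : ℤ)) -
            ((Module.finrank F P.U : ℤ) - (Module.finrank F P.reduce₁.U : ℤ)) := rfl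
        trans (b : ℤ)
        · simp [Finset.card_filter, -Finset.sum_boole, h0]
        · omega
      · rw [show P.countLRT (k + 1) = P.reduce₁.countLRT k from rfl, ← h1 k (by omega)]
        simp [Finset.card_filter, -Finset.sum_boole]
    · rintro (_ | k) hk
      · have h0 : ∀ i, p i ≠ 0 := fun i => (hpq i).1.ne'
        have h4 : P.countIJ 0 =
          ((Module.finrank F P.U : ℤ) - (Module.finrank F P.reduce₁.U : ℤ)) -
            ((Module.finrank F P.reduce₁.V : ℤ) -
              (Module.finrank F P.reduce₁.reduce₁.V : ℤ)) := rfl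
        trans (a : ℤ)
        · simp [Finset.card_filter, -Finset.sum_boole, h0]
        · omega
      · rw [show P.countIJ (k + 1) = P.reduce₁.countIJ k from rfl, ← h2 k (by omega)]
        simp [Finset.card_filter, -Finset.sum_boole]

/-- The matrix pair of one chain: `n`-th vector to `n`-th vector, and to the next one. -/
def _root_.MatrixPair.chain (F : Type w) [Field F] (p q : ℕ) : MatrixPair F where
  rows := Fin p
  cols := Fin q
  fst := Matrix.of fun i j => if (i : ℕ) = j then 1 else 0
  snd := Matrix.of fun i j => if (i : ℕ) = j + 1 then 1 else 0

/-- A chain basis prescribes `A` only at positions below `p i`; the bound `q i ≤ p i` ensures that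
every source vector is covered. -/
theorem HasChains.isGivenBy {P : LinearPair.{u, v, w} F} {X : MatrixPair F} {ι : Type}
    [Fintype ι] [DecidableEq ι] {p q : ι → ℕ} (h : HasChains P X p q) (hqp : ∀ i, q i ≤ p i) :
    P.IsGivenBy (X.oplus (MatrixPair.directSum fun i => MatrixPair.chain F (p i) (q i))) := by
  obtain ⟨b, c, h⟩ := h
  let M : ∀ i, Matrix (Fin (p i)) (Fin (q i)) F := fun i =>
    Matrix.of fun r s => if (r : ℕ) = s then 1 else 0
  let N : ∀ i, Matrix (Fin (p i)) (Fin (q i)) F := fun i =>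
    Matrix.of fun r s => if (r : ℕ) = s + 1 then 1 else 0
  refine isGivenBy_of_apply (X := ⟨X.rows ⊕ Σ i, Fin (p i), X.cols ⊕ Σ i, Fin (q i),
    Matrix.fromBlocks X.fst 0 0 (Matrix.blockDiagonal' M),
    Matrix.fromBlocks X.snd 0 0 (Matrix.blockDiagonal' N)⟩) b c ?_ ?_
  · rintro (j | ⟨i, n, hn⟩)
    · simp only [h.A_inl]
      simp
    · have hn' := hn.trans_le (hqp i)
      simp only [h.A_inr i n hn' hn]
      rw [Finset.sum_eq_single (Sum.inr ⟨i, n, hn'⟩)]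
      · simp [M, Matrix.blockDiagonal'_apply_eq]
      · rintro (r | ⟨k, m, hm⟩) - hne
        · simp
        · by_cases hk : k = i
          · subst hk
            have : m ≠ n := by rintro rfl; exact hne rfl
            simp [Matrix.blockDiagonal'_apply_eq, M, this]
          · simp [Matrix.blockDiagonal'_apply_ne _ _ _ hk]
      · intro h'; exact absurd (Finset.mem_univ _) h'
  · rintro (j | ⟨i, n, hn⟩)
    · simp only [h.B_inl]
      simp
    · have key : ∀ x : X.rows ⊕ Σ i, Fin (p i), (∀ h, x ≠ .inr ⟨i, n + 1, h⟩) →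
          Matrix.fromBlocks X.snd 0 0 (Matrix.blockDiagonal' N) x (.inr ⟨i, n, hn⟩) • c x = 0 := by
        rintro (r | ⟨k, m, hm⟩) hne
        · simp
        · by_cases hk : k = i
          · subst hk
            have : m ≠ n + 1 := by rintro rfl; exact hne hm rfl
            simp [Matrix.blockDiagonal'_apply_eq, N, this]
          · simp [Matrix.blockDiagonal'_apply_ne _ _ _ hk]
      by_cases hn' : n + 1 < p i
      · simp only [h.B_inr i n hn' hn]
        rw [Finset.sum_eq_single (Sum.inr ⟨i, n + 1, hn'⟩)]
        · simp [N, Matrix.blockDiagonal'_apply_eq]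
        · exact fun x _ hx => key x fun _ => hx
        · intro h'; exact absurd (Finset.mem_univ _) h'
      · simp only [h.B_last i n hn (by omega)]
        exact (Finset.sum_eq_zero fun x _ => key x fun h => absurd h hn').symm

theorem _root_.MatrixPair.chain_eq_IJ (k : ℕ) :
    MatrixPair.chain F k k = singularBlock F .IJ k := by
  simp only [MatrixPair.chain, singularBlock]
  congr 1
  ext i j
  simp [Matrix.one_apply, Fin.ext_iff]

theorem _root_.MatrixPair.chain_eq_LRT (k : ℕ) :
    MatrixPair.chain F k (k - 1) = singularBlock F .LRT k := rfl

end LinearPair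

/-! ### Termination, interchange of the mappings, and duality -/

namespace LinearPair
variable {F : Type w} [Field F]

theorem exists_iterate_of_measure {α : Type*} (f : α → α) (d : α → ℕ) (p good : α → Prop)
    (hp : ∀ a, p a → p (f a)) (hd : ∀ a, p a → ¬ good a → d (f a) < d a) (a : α) (ha : p a) :
    ∃ n, good (f^[n] a) := by
  induction h : d a using Nat.strong_induction_on generalizing a with
  | _ k ih =>
    by_cases hg : good a
    · exact ⟨0, hg⟩
    · obtain ⟨n, hn⟩ := ih _ (h ▸ hd a ha hg) (f a) (hp a ha) rfl
      exact ⟨n + 1, hn⟩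

/-- The pair `(B, A)`. -/
def swap (P : LinearPair.{u, v, w} F) : LinearPair.{u, v, w} F where
  U := P.U
  V := P.V
  A := P.B
  B := P.A

/-- The pair of the dual mappings. -/
def dual (P : LinearPair.{u, v, w} F) : LinearPair.{max v w, max u w, w} F where
  U := Module.Dual F P.V
  V := Module.Dual F P.U
  A := P.A.dualMap
  B := P.B.dualMap

/-- Isomorphism of pairs of linear mappings. -/
def IsIso (P : LinearPair.{u, v, w} F) (Q : LinearPair.{u', v', w} F) : Prop :=
  ∃ (e : P.U ≃ₗ[F] Q.U) (f : P.V ≃ₗ[F] Q.V),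
    (∀ x, f (P.A x) = Q.A (e x)) ∧ ∀ x, f (P.B x) = Q.B (e x)

/-- All spaces are finite-dimensional. -/
def IsFinite (P : LinearPair.{u, v, w} F) : Prop :=
  FiniteDimensional F P.U ∧ FiniteDimensional F P.V

variable {P : LinearPair.{u, v, w} F} {Q : LinearPair.{u', v', w} F}

theorem IsIso.refl (P : LinearPair.{u, v, w} F) : P.IsIso P :=
  ⟨LinearEquiv.refl _ _, LinearEquiv.refl _ _, fun _ => rfl, fun _ => rfl⟩

theorem IsIso.symm (h : P.IsIso Q) : Q.IsIso P := by
  obtain ⟨e, f, hA, hB⟩ := h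
  refine ⟨e.symm, f.symm, fun x => ?_, fun x => ?_⟩
  · rw [LinearEquiv.symm_apply_eq, hA, e.apply_symm_apply]
  · rw [LinearEquiv.symm_apply_eq, hB, e.apply_symm_apply]

theorem IsIso.trans {R : LinearPair.{u'', v'', w} F} (h : P.IsIso Q) (h' : Q.IsIso R) :
    P.IsIso R := by
  obtain ⟨e, f, hA, hB⟩ := h
  obtain ⟨e', f', hA', hB'⟩ := h'
  exact ⟨e.trans e', f.trans f', fun x => by simp [hA, hA'], fun x => by simp [hB, hB']⟩

theorem IsIso.dimV_eq (h : P.IsIso Q) : P.dimV = Q.dimV := by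
  obtain ⟨-, f, -⟩ := h
  simp only [dimV, f.finrank_eq]

theorem IsIso.isGivenBy (h : P.IsIso Q) {X : MatrixPair F} (hX : P.IsGivenBy X) :
    Q.IsGivenBy X := by
  obtain ⟨e, f, hA, hB⟩ := h
  obtain ⟨b, c, hA', hB'⟩ := hX
  refine isGivenBy_of_apply (b.map e) (c.map f) (fun j => ?_) fun j => ?_
  · simp [← hA, IsGivenBy.apply_eq hA']
  · simp [← hB, IsGivenBy.apply_eq hB']

theorem IsIso.reduce₁ (h : P.IsIso Q) : P.reduce₁.IsIso Q.reduce₁ := by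
  obtain ⟨e, f, hA, hB⟩ := h
  have h2 : (LinearMap.range P.B).map (f : P.V →ₗ[F] Q.V) = LinearMap.range Q.B := by
    ext y
    constructor
    · rintro ⟨_, ⟨x, rfl⟩, rfl⟩
      exact ⟨e x, (hB x).symm⟩
    · rintro ⟨x, rfl⟩
      exact ⟨_, ⟨e.symm x, rfl⟩, by simp [hB]⟩
  have h1 : ((LinearMap.range P.B).comap P.A).map (e : P.U →ₗ[F] Q.U) =
      (LinearMap.range Q.B).comap Q.A := by
    rw [← h2]
    ext y
    constructor
    · rintro ⟨x, hx, rfl⟩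
      exact ⟨_, hx, hA x⟩
    · rintro ⟨x, hx, hxy⟩
      refine ⟨e.symm y, ?_, by simp⟩
      have : P.A (e.symm y) = x := f.injective (by rw [hA]; simpa using hxy.symm)
      simpa [this] using hx
  refine ⟨e.ofSubmodules _ _ h1, f.ofSubmodules _ _ h2, fun x => ?_, fun x => ?_⟩
  · exact Subtype.ext (hA _)
  · exact Subtype.ext (hB _)

theorem IsIso.iterate_reduce₁ (h : P.IsIso Q) (n : ℕ) :
    (LinearPair.reduce₁^[n] P).IsIso (LinearPair.reduce₁^[n] Q) := by
  induction n with
  | zero => exact h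
  | succ n ih => simpa only [Function.iterate_succ_apply'] using ih.reduce₁

/-- The dual of a quotient is an annihilator: that of Ker B is the image of the dual of B, and that
of A(Ker B) is the preimage of the former under the dual of A. -/
theorem dual_reduce₃ (P : LinearPair.{u, v, w} F) : P.reduce₃.dual.IsIso P.dual.reduce₁ := by
  have h1 : (LinearMap.ker P.B).dualAnnihilator = LinearMap.range P.dual.B :=
    P.B.range_dualMap_eq_dualAnnihilator_ker.symm
  have h2 : ((LinearMap.ker P.B).map P.A).dualAnnihilator =
      (LinearMap.range P.dual.B).comap P.dual.A := by
    ext φ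
    have h3 : φ ∈ (LinearMap.range P.dual.B).comap P.dual.A ↔
        P.A.dualMap φ ∈ (LinearMap.ker P.B).dualAnnihilator := by
      rw [h1]; rfl
    refine Iff.trans ?_ h3.symm
    rw [Submodule.mem_dualAnnihilator, Submodule.mem_dualAnnihilator]
    constructor
    · exact fun h x hx => h _ ⟨x, hx, rfl⟩
    · rintro h _ ⟨x, hx, rfl⟩
      exact h x hx
  refine ⟨(Submodule.dualQuotEquivDualAnnihilator _).trans (LinearEquiv.ofEq _ _ h2),
    (Submodule.dualQuotEquivDualAnnihilator _).trans (LinearEquiv.ofEq _ _ h1),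
    fun φ => ?_, fun φ => ?_⟩
  · exact Subtype.ext (LinearMap.ext fun x => rfl)
  · exact Subtype.ext (LinearMap.ext fun x => rfl)

theorem dual_iterate_reduce₃ (P : LinearPair.{u, v, w} F) (n : ℕ) :
    (reduce₃^[n] P).dual.IsIso (reduce₁^[n] P.dual) := by
  induction n with
  | zero => exact IsIso.refl _
  | succ n ih =>
    simp only [Function.iterate_succ_apply']
    exact (dual_reduce₃ _).trans ih.reduce₁

/-- `reduce₂` is by definition `reduce₁` conjugated by `swap`, so an equality holds here and no
isomorphism is needed. -/
theorem iterate_reduce₂ (P : LinearPair.{u, v, w} F) (n : ℕ) :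
    reduce₂^[n] P = (reduce₁^[n] P.swap).swap := by
  induction n generalizing P with
  | zero => rfl
  | succ n ih => exact ih P.reduce₂

theorem dual_dual (P : LinearPair.{u, v, w} F) [FiniteDimensional F P.U]
    [FiniteDimensional F P.V] : P.IsIso P.dual.dual :=
  ⟨Module.evalEquiv F P.U, Module.evalEquiv F P.V, fun _ => rfl, fun _ => rfl⟩

theorem IsGivenBy.swap {X : MatrixPair F} (h : P.IsGivenBy X) :
    P.swap.IsGivenBy ⟨X.rows, X.cols, X.snd, X.fst⟩ := by
  obtain ⟨b, c, hA, hB⟩ := h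
  exact ⟨b, c, hB, hA⟩

theorem IsGivenBy.dual {X : MatrixPair F} (h : P.IsGivenBy X) :
    P.dual.IsGivenBy ⟨X.cols, X.rows, X.fstᵀ, X.sndᵀ⟩ := by
  obtain ⟨b, c, hA, hB⟩ := h
  refine ⟨c.dualBasis, b.dualBasis, ?_, ?_⟩
  · rw [← hA]; exact LinearMap.toMatrix_transpose ..
  · rw [← hB]; exact LinearMap.toMatrix_transpose ..

theorem IsFinite.reduce₁ (h : P.IsFinite) : P.reduce₁.IsFinite :=
  have := h.1
  ⟨inferInstance, inferInstance⟩

theorem IsFinite.swap (h : P.IsFinite) : P.swap.IsFinite := h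

theorem IsFinite.dual (h : P.IsFinite) : P.dual.IsFinite :=
  have := h.1
  have := h.2
  ⟨inferInstanceAs (FiniteDimensional F (Module.Dual F P.V)),
    inferInstanceAs (FiniteDimensional F (Module.Dual F P.U))⟩

theorem IsFinite.reduce₃ (h : P.IsFinite) : P.reduce₃.IsFinite :=
  have := h.1
  have := h.2
  ⟨inferInstanceAs (FiniteDimensional F (P.U ⧸ LinearMap.ker P.B)),
    inferInstanceAs (FiniteDimensional F (P.V ⧸ (LinearMap.ker P.B).map P.A))⟩

theorem IsFinite.iterate_reduce₁ (h : P.IsFinite) (n : ℕ) :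
    (LinearPair.reduce₁^[n] P).IsFinite :=
  Function.Iterate.rec _ h (fun _ h => IsFinite.reduce₁ h) n

theorem IsFinite.iterate_reduce₂ (h : P.IsFinite) (n : ℕ) : (reduce₂^[n] P).IsFinite := by
  rw [LinearPair.iterate_reduce₂]
  exact (h.swap.iterate_reduce₁ n).swap

theorem IsFinite.iterate_reduce₃ (h : P.IsFinite) (n : ℕ) :
    (LinearPair.reduce₃^[n] P).IsFinite :=
  Function.Iterate.rec _ h (fun _ h => IsFinite.reduce₃ h) n

theorem exists_surjective_B (h : P.IsFinite) :
    ∃ n, Function.Surjective (LinearPair.reduce₁^[n] P).B := by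
  refine exists_iterate_of_measure LinearPair.reduce₁ (fun Q => Module.finrank F Q.V) IsFinite
    (fun Q => Function.Surjective Q.B) (fun _ h => h.reduce₁) (fun Q hQ hB => ?_) P h
  have := hQ.2
  exact Submodule.finrank_lt (mt LinearMap.range_eq_top.1 hB)

theorem exists_surjective_A (h : P.IsFinite) :
    ∃ n, Function.Surjective (reduce₂^[n] P).A := by
  obtain ⟨n, hn⟩ := exists_surjective_B h.swap
  exact ⟨n, by rw [iterate_reduce₂]; exact hn⟩

theorem surjective_A_reduce₁ (h : Function.Surjective P.A) : Function.Surjective P.reduce₁.A := by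
  rintro ⟨y, hy⟩
  obtain ⟨x, rfl⟩ := h y
  exact ⟨⟨x, hy⟩, rfl⟩

theorem surjective_A_iterate_reduce₁ (h : Function.Surjective P.A) (n : ℕ) :
    Function.Surjective (reduce₁^[n] P).A :=
  Function.Iterate.rec (fun Q : LinearPair F => Function.Surjective Q.A)
    h (fun _ h => surjective_A_reduce₁ h) n

theorem surjective_B_iterate_reduce₂ (h : Function.Surjective P.B) (n : ℕ) :
    Function.Surjective (reduce₂^[n] P).B := by
  rw [iterate_reduce₂]
  exact surjective_A_iterate_reduce₁ (P := P.swap) h n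

theorem surjective_reduce₃ (h : Function.Surjective P.A ∧ Function.Surjective P.B) :
    Function.Surjective P.reduce₃.A ∧ Function.Surjective P.reduce₃.B := by
  constructor
  · intro y
    obtain ⟨y, rfl⟩ := Submodule.Quotient.mk_surjective _ y
    obtain ⟨x, rfl⟩ := h.1 y
    exact ⟨Submodule.Quotient.mk x, rfl⟩
  · intro y
    obtain ⟨y, rfl⟩ := Submodule.Quotient.mk_surjective _ y
    obtain ⟨x, rfl⟩ := h.2 y
    exact ⟨Submodule.Quotient.mk x, rfl⟩

theorem surjective_iterate_reduce₃ (h : Function.Surjective P.A ∧ Function.Surjective P.B)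
    (n : ℕ) : Function.Surjective (reduce₃^[n] P).A ∧ Function.Surjective (reduce₃^[n] P).B :=
  Function.Iterate.rec (fun Q : LinearPair F => Function.Surjective Q.A ∧ Function.Surjective Q.B)
    h (fun _ h => surjective_reduce₃ h) n

theorem exists_bijective_B (h : P.IsFinite)
    (hs : Function.Surjective P.A ∧ Function.Surjective P.B) :
    ∃ n, Function.Bijective (LinearPair.reduce₃^[n] P).B := by
  -- Only injectivity has to be reached: a nonzero Ker B lowers dim U, while surjectivity passes to
  -- quotients.
  have h1 : ∃ n, Function.Injective (LinearPair.reduce₃^[n] P).B := by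
    refine exists_iterate_of_measure LinearPair.reduce₃ (fun Q => Module.finrank F Q.U) IsFinite
      (fun Q => Function.Injective Q.B) (fun _ h => h.reduce₃) (fun Q hQ hB => ?_) P h
    have := hQ.1
    have h2 := Submodule.finrank_quotient_add_finrank (LinearMap.ker Q.B)
    have h3 : 0 < Module.finrank F (LinearMap.ker Q.B) := by
      rw [Module.finrank_pos_iff, Submodule.nontrivial_iff_ne_bot]
      exact mt LinearMap.ker_eq_bot.1 hB
    have h4 : Module.finrank F Q.reduce₃.U = Module.finrank F (Q.U ⧸ LinearMap.ker Q.B) := rfl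
    omega
  obtain ⟨n, hn⟩ := h1
  exact ⟨n, hn, (surjective_iterate_reduce₃ hs n).2⟩

/-- A surjective A induces an isomorphism from U/A⁻¹(im B) onto V/im B. -/
theorem dimU_add_dimV_reduce₁ (hP : P.IsFinite) (h : Function.Surjective P.A) :
    P.dimU - P.reduce₁.dimU = P.dimV - P.reduce₁.dimV := by
  have := hP.1
  have := hP.2
  have h1 := finrank_comap_add_finrank_sup_range P.A (LinearMap.range P.B)
  rw [LinearMap.range_eq_top.2 h, sup_top_eq, finrank_top] at h1
  have h2 : P.reduce₁.dimU = (Module.finrank F ↥((LinearMap.range P.B).comap P.A) : ℤ) := rfl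
  have h3 : P.reduce₁.dimV = (Module.finrank F ↥(LinearMap.range P.B) : ℤ) := rfl
  rw [h2, h3, dimU, dimV]
  omega

theorem counts_of_surjective_A (hP : P.IsFinite) (h : Function.Surjective P.A) (n : ℕ) :
    P.countLRT n = 0 ∧ P.countIJ n = (reduce₁^[n] P).dimV - 2 * (reduce₁^[n + 1] P).dimV
      + (reduce₁^[n + 2] P).dimV := by
  have h1 := dimU_add_dimV_reduce₁ (hP.iterate_reduce₁ n) (surjective_A_iterate_reduce₁ h n)
  rw [← Function.iterate_succ_apply' reduce₁] at h1
  simp only [countLRT, countIJ, Nat.succ_eq_add_one] at h1 ⊢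
  constructor <;> linarith

theorem injective_B_iterate_reduce₁ (h : Function.Injective P.B) (n : ℕ) :
    Function.Injective (reduce₁^[n] P).B :=
  Function.Iterate.rec (fun Q : LinearPair F => Function.Injective Q.B)
    h (fun _ h _ _ hxy => Subtype.ext (h (congrArg Subtype.val hxy))) n

/-- Injectivity persists, so each space V at the next stage, being im B, has the dimension of the
current U. -/
theorem counts_of_injective_B (h : Function.Injective P.B) (n : ℕ) :
    P.countIJ n = 0 ∧ P.countLRT n = (reduce₁^[n] P).dimV - 2 * (reduce₁^[n + 1] P).dimV
      + (reduce₁^[n + 2] P).dimV := by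
  have h1 : ∀ n, (reduce₁^[n + 1] P).dimV = (reduce₁^[n] P).dimU := by
    intro n
    rw [Function.iterate_succ_apply']
    exact congrArg Nat.cast (LinearMap.finrank_range_of_inj (injective_B_iterate_reduce₁ h n))
  have h2 := h1 n
  have h3 : (reduce₁^[n + 2] P).dimV = (reduce₁^[n + 1] P).dimU := h1 (n + 1)
  simp only [countLRT, countIJ]
  constructor <;> linarith

end LinearPair

/-! ### Changes of basis and reindexing of direct sums -/

theorem isNonsingular_toMatrix {F : Type w} [Field F] {m n : Type} [Fintype m] [DecidableEq m]
    [Fintype n] [DecidableEq n] {U : Type u} {V : Type v} [AddCommGroup U] [Module F U]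
    [AddCommGroup V] [Module F V] (b : Module.Basis n F U) (c : Module.Basis m F V)
    (f : U →ₗ[F] V) (hf : Function.Bijective f) : IsNonsingular (LinearMap.toMatrix b c f) := by
  let e := LinearEquiv.ofBijective f hf
  refine ⟨LinearMap.toMatrix c b e.symm.toLinearMap, ?_, ?_⟩
  · rw [← LinearMap.toMatrix_comp c b c,
      show f ∘ₗ e.symm.toLinearMap = LinearMap.id from
        LinearMap.ext fun x => e.apply_symm_apply x, LinearMap.toMatrix_id]
  · rw [← LinearMap.toMatrix_comp b c b,
      show e.symm.toLinearMap ∘ₗ f = LinearMap.id from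
        LinearMap.ext fun x => e.symm_apply_apply x, LinearMap.toMatrix_id]

theorem blockDiagonal'_apply_of_injective {α ι κ : Type*} [Zero α] [DecidableEq ι]
    [DecidableEq κ] {m n : ι → Type*} (N : ∀ i, Matrix (m i) (n i) α) {e : κ → ι}
    (he : Function.Injective e) (i j : κ) (r : m (e i)) (s : n (e j)) :
    Matrix.blockDiagonal' N ⟨e i, r⟩ ⟨e j, s⟩ =
      Matrix.blockDiagonal' (fun i => N (e i)) ⟨i, r⟩ ⟨j, s⟩ := by
  by_cases hij : i = j
  · subst hij
    rw [Matrix.blockDiagonal'_apply_eq, Matrix.blockDiagonal'_apply_eq]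
  · rw [Matrix.blockDiagonal'_apply_ne _ _ _ hij, Matrix.blockDiagonal'_apply_ne _ _ _ (he.ne hij)]

namespace MatrixPair
variable {F : Type w} [Field F]

/-- The pair of transposed matrices. -/
def transpose (X : MatrixPair F) : MatrixPair F where
  rows := X.cols
  cols := X.rows
  fst := X.fstᵀ
  snd := X.sndᵀ

/-- The pair with its matrices interchanged. -/
def swap (X : MatrixPair F) : MatrixPair F where
  rows := X.rows
  cols := X.cols
  fst := X.snd
  snd := X.fst

theorem transpose_oplus (X Y : MatrixPair F) :
    (X.oplus Y).transpose = X.transpose.oplus Y.transpose := by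
  simp only [transpose, oplus]
  congr 1 <;> rw [Matrix.fromBlocks_transpose] <;> rfl

theorem transpose_directSum {ι : Type} [Fintype ι] [DecidableEq ι] (X : ι → MatrixPair F) :
    (directSum X).transpose = directSum fun i => (X i).transpose := by
  simp only [transpose, directSum]
  congr 1 <;> rw [Matrix.blockDiagonal'_transpose]

end MatrixPair

namespace LinearPair
variable {F : Type w} [Field F] {P : LinearPair.{u, v, w} F}

theorem IsGivenBy.reindex {X Y : MatrixPair F} (h : P.IsGivenBy X) (er : Y.rows ≃ X.rows)
    (ec : Y.cols ≃ X.cols) (h1 : ∀ i j, X.fst (er i) (ec j) = Y.fst i j)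
    (h2 : ∀ i j, X.snd (er i) (ec j) = Y.snd i j) : P.IsGivenBy Y := by
  obtain ⟨b, c, hA, hB⟩ := h
  refine ⟨b.reindex ec.symm, c.reindex er.symm, ?_, ?_⟩ <;> ext i j
  · rw [← h1, ← hA]; simp [LinearMap.toMatrix_apply]
  · rw [← h2, ← hB]; simp [LinearMap.toMatrix_apply]

theorem IsGivenBy.directSum_sum {X : MatrixPair F} {ι κ : Type} [Fintype ι] [Fintype κ]
    [DecidableEq ι] [DecidableEq κ] {f : ι ⊕ κ → MatrixPair F}
    (h : P.IsGivenBy ((X.oplus (MatrixPair.directSum fun i => f (.inl i))).oplus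
      (MatrixPair.directSum fun i => f (.inr i)))) :
    P.IsGivenBy (X.oplus (MatrixPair.directSum f)) := by
  refine h.reindex
    (((Equiv.refl X.rows).sumCongr (Equiv.sumSigmaDistrib _)).trans (Equiv.sumAssoc _ _ _).symm)
    (((Equiv.refl X.cols).sumCongr (Equiv.sumSigmaDistrib _)).trans (Equiv.sumAssoc _ _ _).symm)
    ?_ ?_ <;> rintro (i | ⟨i | i, i'⟩) (j | ⟨j | j, j'⟩) <;> try rfl
  · exact (blockDiagonal'_apply_of_injective (fun i => (f i).fst) Sum.inl_injective i j i' j').symm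
  · exact (blockDiagonal'_apply_of_injective (fun i => (f i).fst) Sum.inr_injective i j i' j').symm
  · exact (blockDiagonal'_apply_of_injective (fun i => (f i).snd) Sum.inl_injective i j i' j').symm
  · exact (blockDiagonal'_apply_of_injective (fun i => (f i).snd) Sum.inr_injective i j i' j').symm

theorem IsGivenBy.directSum_reindex {X : MatrixPair F} {ι κ : Type} [Fintype ι] [Fintype κ]
    [DecidableEq ι] [DecidableEq κ] {f : ι → MatrixPair F}
    (h : P.IsGivenBy (X.oplus (MatrixPair.directSum f))) (e : κ ≃ ι) :
    P.IsGivenBy (X.oplus (MatrixPair.directSum fun i => f (e i))) := by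
  refine h.reindex
    ((Equiv.refl X.rows).sumCongr (Equiv.sigmaCongrLeft (β := fun i => (f i).rows) e))
    ((Equiv.refl X.cols).sumCongr (Equiv.sigmaCongrLeft (β := fun i => (f i).cols) e)) ?_ ?_ <;>
    rintro (i | ⟨i, i'⟩) (j | ⟨j, j'⟩) <;> try rfl
  · exact blockDiagonal'_apply_of_injective (fun i => (f i).fst) e.injective i j i' j'
  · exact blockDiagonal'_apply_of_injective (fun i => (f i).snd) e.injective i j i' j'

theorem IsGivenBy.isEquivalent {X Y : MatrixPair F} (hX : P.IsGivenBy X) (hY : P.IsGivenBy Y) :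
    X.IsEquivalent Y := by
  obtain ⟨b, c, hA, hB⟩ := hX
  obtain ⟨b', c', hA', hB'⟩ := hY
  refine ⟨LinearMap.toMatrix c c' LinearMap.id, LinearMap.toMatrix b b' LinearMap.id,
    isNonsingular_toMatrix _ _ _ Function.bijective_id,
    isNonsingular_toMatrix _ _ _ Function.bijective_id, ?_, ?_⟩
  · rw [← hA, ← hA', ← LinearMap.toMatrix_comp b c c', ← LinearMap.toMatrix_comp b b' c']
    rfl
  · rw [← hB, ← hB', ← LinearMap.toMatrix_comp b c c', ← LinearMap.toMatrix_comp b b' c']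
    rfl

theorem exists_isGivenBy (h : P.IsFinite) : ∃ X, P.IsGivenBy X :=
  have := h.1
  have := h.2
  ⟨⟨_, _, LinearMap.toMatrix (Module.finBasis F P.U) (Module.finBasis F P.V) P.A,
    LinearMap.toMatrix (Module.finBasis F P.U) (Module.finBasis F P.V) P.B⟩,
    Module.finBasis F P.U, Module.finBasis F P.V, rfl, rfl⟩

/-- Choose any basis of U and transport it to V by A. -/
theorem exists_isGivenBy_idPair (h : P.IsFinite) (hA : Function.Bijective P.A) :
    ∃ (r : ℕ) (D : Matrix (Fin r) (Fin r) F), P.IsGivenBy (MatrixPair.idPair D) := by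
  have := h.1
  let b := Module.finBasis F P.U
  let c := b.map (LinearEquiv.ofBijective P.A hA)
  have h1 : LinearMap.toMatrix b c P.A = 1 := by
    ext i j
    have : P.A (b j) = c j := rfl
    rw [LinearMap.toMatrix_apply, this, Module.Basis.repr_self]
    simp [Matrix.one_apply, Finsupp.single_apply, eq_comm]
  exact ⟨_, LinearMap.toMatrix b c P.B, b, c, h1, rfl⟩

/-! ### Singular blocks split off by each of the three reductions -/

theorem exists_blocks_reduce₁ (n : ℕ) (hP : P.IsFinite) (X : MatrixPair F)
    (hX : ∃ T : Matrix X.cols X.rows F, X.snd * T = 1) (h : (reduce₁^[n] P).IsGivenBy X) :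
    ∃ (ι : Type) (_ : Fintype ι) (_ : DecidableEq ι) (s : ι → BlockKind) (k : ι → ℕ),
      (∀ i, (s i = .LRT ∨ s i = .IJ) ∧ 0 < k i ∧ k i ≤ n) ∧
      (∀ j < n, ((Finset.univ.filter fun i => s i = .LRT ∧ k i = j + 1).card : ℤ) =
        P.countLRT j) ∧
      (∀ j < n, ((Finset.univ.filter fun i => s i = .IJ ∧ k i = j + 1).card : ℤ) =
        P.countIJ j) ∧
      P.IsGivenBy (X.oplus (MatrixPair.directSum fun i => singularBlock F (s i) (k i))) := by
  classical
  have := hP.1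
  have := hP.2
  obtain ⟨ι, _, p, q, hpq, h1, h2, h3⟩ := exists_hasChains n P X hX h
  refine ⟨ι, inferInstance, inferInstance, fun i => if q i = p i then .IJ else .LRT, p,
    fun i => ⟨?_, (hpq i).1, (hpq i).2.1⟩, fun j hj => ?_, fun j hj => ?_, ?_⟩
  · dsimp only
    split_ifs <;> simp
  · rw [← h1 j hj]
    congr 2
    ext i
    have := hpq i
    by_cases hi : q i = p i <;> simp [hi] <;> omega
  · rw [← h2 j hj]
    congr 2
    ext i
    have := hpq i
    by_cases hi : q i = p i <;> simp [hi]
    omega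
  · have h4 := h3.isGivenBy fun i => by have := hpq i; omega
    convert h4 using 4 with i
    by_cases hi : q i = p i
    · simp only [hi, if_true]
      exact (MatrixPair.chain_eq_IJ _).symm
    · simp only [hi, if_false]
      rw [← MatrixPair.chain_eq_LRT]
      congr 1
      have := hpq i
      omega

theorem exists_blocks_reduce₂ (n : ℕ) (hP : P.IsFinite) (hB : Function.Surjective P.B)
    (X : MatrixPair F) (hX : ∃ T : Matrix X.cols X.rows F, X.fst * T = 1)
    (h : (reduce₂^[n] P).IsGivenBy X) :
    ∃ (ι : Type) (_ : Fintype ι) (_ : DecidableEq ι) (k : ι → ℕ),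
      (∀ i, 0 < k i ∧ k i ≤ n) ∧
      (∀ j < n, ((Finset.univ.filter fun i => k i = j + 1).card : ℤ) =
        (reduce₂^[j] P).dimV - 2 * (reduce₂^[j + 1] P).dimV + (reduce₂^[j + 2] P).dimV) ∧
      P.IsGivenBy (X.oplus (MatrixPair.directSum fun i => singularBlock F .JI (k i))) := by
  classical
  have hP' := hP.swap
  have := hP'.1
  have := hP'.2
  rw [iterate_reduce₂] at h
  obtain ⟨ι, _, p, q, hpq, h1, h2, h3⟩ := exists_hasChains n P.swap X.swap hX h.swap
  -- A chain with fewer source than target vectors would be counted by `countLRT`, which vanishes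
  -- because the first map of the swapped pair is onto.
  have hq : ∀ i, q i = p i := by
    intro i
    rcases (hpq i).2.2 with hi | hi
    · exact hi
    · have hn : q i < n := by have := hpq i; omega
      have h4 := h1 (q i) hn
      rw [(counts_of_surjective_A hP' hB _).1, Nat.cast_eq_zero, Finset.card_eq_zero] at h4
      exact absurd (Finset.mem_filter.2 ⟨Finset.mem_univ i, hi.symm, rfl⟩)
        (h4 ▸ Finset.notMem_empty i)
  obtain rfl : q = p := funext hq
  refine ⟨ι, inferInstance, inferInstance, q, fun i => ⟨(hpq i).1, (hpq i).2.1⟩,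
    fun j hj => ?_, ?_⟩
  · have h4 := h2 j hj
    rw [(counts_of_surjective_A hP' hB j).2] at h4
    simp only [iterate_reduce₂]
    refine Eq.trans ?_ h4
    congr 2
    ext i
    simp
  · have h4 := h3.isGivenBy fun i => le_rfl
    simp only [MatrixPair.chain_eq_IJ] at h4
    exact h4.swap

theorem exists_blocks_reduce₃ (n : ℕ) (hP : P.IsFinite) (hB : Function.Surjective P.B)
    (X : MatrixPair F) (hX : ∃ T : Matrix X.cols X.rows F, T * X.snd = 1)
    (h : (reduce₃^[n] P).IsGivenBy X) :
    ∃ (ι : Type) (_ : Fintype ι) (_ : DecidableEq ι) (k : ι → ℕ),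
      (∀ i, 0 < k i ∧ k i ≤ n) ∧
      (∀ j < n, ((Finset.univ.filter fun i => k i = j + 1).card : ℤ) =
        (reduce₃^[j] P).dimU - 2 * (reduce₃^[j + 1] P).dimU + (reduce₃^[j + 2] P).dimU) ∧
      P.IsGivenBy (X.oplus (MatrixPair.directSum fun i => singularBlock F .LR (k i))) := by
  classical
  have hP' := hP.dual
  have := hP.1
  have := hP.2
  have := hP'.1
  have := hP'.2
  have hB' : Function.Injective P.dual.B := LinearMap.dualMap_injective_of_surjective hB
  have hX' : ∃ T : Matrix X.transpose.cols X.transpose.rows F, X.transpose.snd * T = 1 := by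
    obtain ⟨T, hT⟩ := hX
    exact ⟨Tᵀ, ((Matrix.transpose_mul T X.snd).symm.trans (congrArg _ hT)).trans
      Matrix.transpose_one⟩
  have hdim : ∀ j, (reduce₁^[j] P.dual).dimV = (reduce₃^[j] P).dimU := fun j => by
    rw [← (dual_iterate_reduce₃ P j).dimV_eq]
    exact congrArg Nat.cast (Subspace.dual_finrank_eq (K := F) (V := (reduce₃^[j] P).U))
  obtain ⟨ι, _, p, q, hpq, h1, h2, h3⟩ := exists_hasChains n P.dual X.transpose hX'
    ((dual_iterate_reduce₃ P n).isGivenBy h.dual)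
  -- A chain with equally many source and target vectors would be counted by `countIJ`, which
  -- vanishes because the dual of B is injective.
  have hq : ∀ i, q i = p i - 1 := by
    intro i
    rcases (hpq i).2.2 with hi | hi
    · have hn : p i - 1 < n := by have := hpq i; omega
      have h4 := h2 (p i - 1) hn
      rw [(counts_of_injective_B hB' _).1, Nat.cast_eq_zero, Finset.card_eq_zero] at h4
      have := (hpq i).1
      exact absurd (Finset.mem_filter.2 ⟨Finset.mem_univ i, by omega, by omega⟩)
        (h4 ▸ Finset.notMem_empty i)
    · omega
  obtain rfl : q = fun i => p i - 1 := funext hq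
  refine ⟨ι, inferInstance, inferInstance, p, fun i => ⟨(hpq i).1, (hpq i).2.1⟩,
    fun j hj => ?_, ?_⟩
  · have h4 := h1 j hj
    rw [(counts_of_injective_B hB' j).2] at h4
    simp only [hdim] at h4
    rw [← h4]
    congr 2
    ext i
    simp only [Finset.mem_filter, Finset.mem_univ, true_and]
    omega
  -- Dualize the decomposition of the dual pair and return to `P` along the evaluation isomorphisms
  -- with the double dual.
  · have h4 := (dual_dual P).symm.isGivenBy (h3.isGivenBy fun i => Nat.sub_le _ _).dual
    have h5 := MatrixPair.transpose_oplus X.transpose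
      (MatrixPair.directSum fun i => MatrixPair.chain F (p i) (p i - 1))
    rw [MatrixPair.transpose_directSum] at h5
    exact h5 ▸ h4

end LinearPair

/-! ### Assembling the blocks -/

/-- `ι` is the disjoint union of the fibres of (type, size), and each fibre has the prescribed
cardinality. -/
theorem exists_equiv_blockIndex (F : Type w) [Field F] {ι : Type} [Fintype ι]
    (s : ι → BlockKind) (k : ι → ℕ) (ℓ : BlockKind → ℕ) (μ : BlockKind → ℕ → ℕ)
    (hk : ∀ i, 1 ≤ k i ∧ k i < ℓ (s i))
    (hμ : ∀ t j, 1 ≤ j → j < ℓ t →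
      (Finset.univ.filter fun i => s i = t ∧ k i = j).card = μ t j) :
    ∃ e : BlockIndex ℓ μ ≃ ι, ∀ x, singularBlock F (s (e x)) (k (e x)) = blockFamily F ℓ μ x := by
  let e₁ : BlockIndex ℓ μ ≃
      Σ t : BlockKind, Σ j : Finset.Ico 1 (ℓ t), {i // s i = t ∧ k i = j} :=
    Equiv.sigmaCongrRight fun t => Equiv.sigmaCongrRight fun j =>
      (Fintype.equivFinOfCardEq (by
        rw [Fintype.card_subtype]
        exact hμ t j (Finset.mem_Ico.1 j.2).1 (Finset.mem_Ico.1 j.2).2)).symm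
  let e₂ : (Σ t : BlockKind, Σ j : Finset.Ico 1 (ℓ t), {i // s i = t ∧ k i = j}) ≃ ι :=
    { toFun := fun x => x.2.2.1
      invFun := fun i => ⟨s i, ⟨k i, Finset.mem_Ico.2 (hk i)⟩, i, rfl, rfl⟩
      left_inv := by
        rintro ⟨t, ⟨j, hj⟩, i, hi⟩
        obtain ⟨rfl, h⟩ := hi
        dsimp only at h
        subst h
        rfl
      right_inv := fun i => rfl }
  refine ⟨e₁.trans e₂, fun x => ?_⟩
  have h := (e₁ x).2.2.2
  change singularBlock F (s (e₁ x).2.2.1) (k (e₁ x).2.2.1) = singularBlock F x.1 x.2.1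
  rw [h.1, h.2]
  rfl

/-- Stages are numbered from 1, so stage `n + 1` is the `n`-th iterate; a least index `n + 1`
therefore means blocks of size at most `n`. -/
theorem exists_isLeast_stage (good : ℕ → Prop) (h : ∃ n, good n) :
    ∃ n, IsLeast {j : ℕ | 1 ≤ j ∧ good (j - 1)} (n + 1) ∧ good n := by
  classical
  refine ⟨Nat.find h, ⟨⟨by omega, Nat.find_spec h⟩, ?_⟩, Nat.find_spec h⟩
  rintro j ⟨hj, hg⟩
  have := Nat.find_min' h hg
  omega

namespace LinearPair
variable {F : Type w} [Field F]

/-- The multiplicities of the singular blocks, in terms of the dimensions of the stages. -/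
noncomputable def multiplicity (P : LinearPair.{u, v, w} F) (ℓ₁ ℓ₂ : ℕ) : BlockKind → ℕ → ℤ
  | .LRT, j => ((P.stage₁ j).dimV - (P.stage₁ (j + 1)).dimV)
            - ((P.stage₁ j).dimU - (P.stage₁ (j + 1)).dimU)
  | .IJ, j => ((P.stage₁ j).dimU - (P.stage₁ (j + 1)).dimU)
            - ((P.stage₁ (j + 1)).dimV - (P.stage₁ (j + 2)).dimV)
  | .JI, j => (P.stage₂ ℓ₁ j).dimV - 2 * (P.stage₂ ℓ₁ (j + 1)).dimV
            + (P.stage₂ ℓ₁ (j + 2)).dimV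
  | .LR, j => (P.stage₃ ℓ₁ ℓ₂ j).dimU - 2 * (P.stage₃ ℓ₁ ℓ₂ (j + 1)).dimU
            + (P.stage₃ ℓ₁ ℓ₂ (j + 2)).dimU

theorem IsGivenBy.exists_fst_mul_eq_one {P : LinearPair.{u, v, w} F} {X : MatrixPair F}
    (h : P.IsGivenBy X) (hA : Function.Surjective P.A) :
    ∃ T : Matrix X.cols X.rows F, X.fst * T = 1 := by
  obtain ⟨b, c, h, -⟩ := h
  obtain ⟨g, hg⟩ := P.A.exists_rightInverse_of_surjective (LinearMap.range_eq_top.2 hA)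
  exact ⟨LinearMap.toMatrix c b g, by
    rw [← h, ← LinearMap.toMatrix_comp c b c, hg, LinearMap.toMatrix_id]⟩

theorem IsGivenBy.isNonsingular {P : LinearPair.{u, v, w} F} {X : MatrixPair F}
    (h : P.IsGivenBy X) (hA : Function.Bijective P.A) (hB : Function.Bijective P.B) :
    IsNonsingular X.fst ∧ IsNonsingular X.snd := by
  obtain ⟨b, c, h, h'⟩ := h
  rw [← h, ← h']
  exact ⟨isNonsingular_toMatrix _ _ _ hA, isNonsingular_toMatrix _ _ _ hB⟩

theorem exists_blocks (P : LinearPair.{u, v, w} F) (hP : P.IsFinite) (n₁ n₂ n₃ : ℕ)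
    (h₁ : Function.Surjective (P.stage₁ (n₁ + 1)).B)
    (h₂ : Function.Surjective (P.stage₂ (n₁ + 1) (n₂ + 1)).A) (M : MatrixPair F)
    (hM : (P.stage₃ (n₁ + 1) (n₂ + 1) (n₃ + 1)).IsGivenBy M)
    (hM' : IsNonsingular M.snd) :
    ∃ (ι : Type) (_ : Fintype ι) (_ : DecidableEq ι) (s : ι → BlockKind) (k : ι → ℕ),
      (∀ i, 1 ≤ k i ∧ k i < sizeBound (n₁ + 1) (n₂ + 1) (n₃ + 1) (s i)) ∧
      (∀ t j, 1 ≤ j → j < sizeBound (n₁ + 1) (n₂ + 1) (n₃ + 1) t →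
        ((Finset.univ.filter fun i => s i = t ∧ k i = j).card : ℤ) =
          P.multiplicity (n₁ + 1) (n₂ + 1) t j) ∧
      P.IsGivenBy (M.oplus (MatrixPair.directSum fun i => singularBlock F (s i) (k i))) := by
  have hP₁ : (P.stage₁ (n₁ + 1)).IsFinite := hP.iterate_reduce₁ n₁
  have hP₂ : (P.stage₂ (n₁ + 1) (n₂ + 1)).IsFinite := hP₁.iterate_reduce₂ n₂
  have h₁' : Function.Surjective (P.stage₂ (n₁ + 1) (n₂ + 1)).B :=
    surjective_B_iterate_reduce₂ h₁ n₂
  obtain ⟨T, -, hT⟩ := hM'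
  -- The reductions are undone from the last to the first. At each return, what has been assembled
  -- so far plays the part of X, and the stopping condition of that stage supplies the one-sided
  -- inverse needed next.
  obtain ⟨ι₃, _, _, k₃, hk₃, hc₃, hg₃⟩ := exists_blocks_reduce₃ n₃ hP₂ h₁' M ⟨T, hT⟩ hM
  obtain ⟨ι₂, _, _, k₂, hk₂, hc₂, hg₂⟩ :=
    exists_blocks_reduce₂ n₂ hP₁ h₁ _ (hg₃.exists_fst_mul_eq_one h₂) hg₃
  obtain ⟨ι₁, _, _, s₁, k₁, hk₁, hLRT, hIJ, hg₁⟩ :=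
    exists_blocks_reduce₁ n₁ hP _ (hg₂.swap.exists_fst_mul_eq_one h₁) hg₂
  have hLR' : ∀ i, s₁ i ≠ .LR := fun i h => by simpa [h] using (hk₁ i).1
  have hJI' : ∀ i, s₁ i ≠ .JI := fun i h => by simpa [h] using (hk₁ i).1
  refine ⟨ι₃ ⊕ (ι₂ ⊕ ι₁), inferInstance, inferInstance,
    Sum.elim (fun _ => .LR) (Sum.elim (fun _ => .JI) s₁), Sum.elim k₃ (Sum.elim k₂ k₁), ?_, ?_, ?_⟩
  · rintro (i | i | i)
    · exact ⟨(hk₃ i).1, Nat.lt_succ_of_le (hk₃ i).2⟩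
    · exact ⟨(hk₂ i).1, Nat.lt_succ_of_le (hk₂ i).2⟩
    · refine ⟨(hk₁ i).2.1, ?_⟩
      rcases (hk₁ i).1 with h | h <;>
        simp only [Sum.elim_inr, h, sizeBound] <;> exact Nat.lt_succ_of_le (hk₁ i).2.2
  · rintro t (_ | j) hj hjt
    · omega
    simp only [Finset.card_filter, Fintype.sum_sum_type, Sum.elim_inl, Sum.elim_inr]
    cases t
    · simp only [reduceCtorEq, false_and, if_false, Finset.sum_const_zero, zero_add]
      have h := hIJ j (Nat.lt_of_succ_lt_succ hjt)
      rw [Finset.card_filter] at h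
      exact h
    · simp only [reduceCtorEq, hJI', false_and, true_and, if_false, Finset.sum_const_zero,
        zero_add, add_zero, ← Finset.card_filter]
      exact hc₂ j (Nat.lt_of_succ_lt_succ hjt)
    · simp only [reduceCtorEq, hLR', false_and, true_and, if_false, Finset.sum_const_zero,
        add_zero, ← Finset.card_filter]
      exact hc₃ j (Nat.lt_of_succ_lt_succ hjt)
    · simp only [reduceCtorEq, false_and, if_false, Finset.sum_const_zero, zero_add]
      have h := hLRT j (Nat.lt_of_succ_lt_succ hjt)
      rw [Finset.card_filter] at h
      exact h
  · exact IsGivenBy.directSum_sum (IsGivenBy.directSum_sum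
      (f := fun i : ι₂ ⊕ ι₁ => singularBlock F (Sum.elim (fun _ => .JI) s₁ i)
        (Sum.elim k₂ k₁ i)) hg₁)

end LinearPair

theorem theorem2 {F : Type w} [Field F] (P : LinearPair.{u, v, w} F)
    [FiniteDimensional F P.U] [FiniteDimensional F P.V] :
    ∃ ℓ₁ ℓ₂ ℓ₃ : ℕ,
      -- the stopping indices exist and are the first ones with the required property
      IsLeast {j : ℕ | 1 ≤ j ∧ Function.Surjective (P.stage₁ j).B} ℓ₁ ∧
      IsLeast {j : ℕ | 1 ≤ j ∧ Function.Surjective (P.stage₂ ℓ₁ j).A} ℓ₂ ∧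
      IsLeast {j : ℕ | 1 ≤ j ∧ Function.Bijective (P.stage₃ ℓ₁ ℓ₂ j).B} ℓ₃ ∧
      ∃ μ : BlockKind → ℕ → ℕ,
        -- the multiplicities of the singular blocks
        (∀ j, 1 ≤ j → j < ℓ₁ → (μ .LRT j : ℤ) =
          ((P.stage₁ j).dimV - (P.stage₁ (j + 1)).dimV)
            - ((P.stage₁ j).dimU - (P.stage₁ (j + 1)).dimU)) ∧
        (∀ j, 1 ≤ j → j < ℓ₁ → (μ .IJ j : ℤ) =
          ((P.stage₁ j).dimU - (P.stage₁ (j + 1)).dimU)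
            - ((P.stage₁ (j + 1)).dimV - (P.stage₁ (j + 2)).dimV)) ∧
        (∀ j, 1 ≤ j → j < ℓ₂ → (μ .JI j : ℤ) =
          (P.stage₂ ℓ₁ j).dimV - 2 * (P.stage₂ ℓ₁ (j + 1)).dimV
            + (P.stage₂ ℓ₁ (j + 2)).dimV) ∧
        (∀ j, 1 ≤ j → j < ℓ₃ → (μ .LR j : ℤ) =
          (P.stage₃ ℓ₁ ℓ₂ j).dimU - 2 * (P.stage₃ ℓ₁ ℓ₂ (j + 1)).dimU
            + (P.stage₃ ℓ₁ ℓ₂ (j + 2)).dimU) ∧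
        -- the last pair is given by matrix pairs, they are pairs of nonsingular matrices, and
        -- any of them can serve as the regular summand
        (∃ M : MatrixPair F, (P.stage₃ ℓ₁ ℓ₂ ℓ₃).IsGivenBy M) ∧
        (∀ M : MatrixPair F, (P.stage₃ ℓ₁ ℓ₂ ℓ₃).IsGivenBy M →
          IsNonsingular M.fst ∧ IsNonsingular M.snd ∧
          P.IsGivenBy
            (M.oplus (MatrixPair.directSum (blockFamily F (sizeBound ℓ₁ ℓ₂ ℓ₃) μ)))) ∧
        -- with the regular summand written as `(I_r, D)`, the direct sum is a regularizing
        -- decomposition of every matrix pair that gives `P`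
        (∃ (r : ℕ) (D : Matrix (Fin r) (Fin r) F),
          (P.stage₃ ℓ₁ ℓ₂ ℓ₃).IsGivenBy (MatrixPair.idPair D)) ∧
        (∀ (r : ℕ) (D : Matrix (Fin r) (Fin r) F),
          (P.stage₃ ℓ₁ ℓ₂ ℓ₃).IsGivenBy (MatrixPair.idPair D) →
          ∀ X : MatrixPair F, P.IsGivenBy X →
            X.IsRegularizingDecomposition D (blockFamily F (sizeBound ℓ₁ ℓ₂ ℓ₃) μ)) := by
  have hP : P.IsFinite := ⟨inferInstance, inferInstance⟩
  obtain ⟨n₁, hn₁, h₁⟩ := exists_isLeast_stage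
    (fun n => Function.Surjective (LinearPair.reduce₁^[n] P).B) (LinearPair.exists_surjective_B hP)
  have hP₁ : (P.stage₁ (n₁ + 1)).IsFinite := hP.iterate_reduce₁ n₁
  obtain ⟨n₂, hn₂, h₂⟩ := exists_isLeast_stage
    (fun n => Function.Surjective (LinearPair.reduce₂^[n] (P.stage₁ (n₁ + 1))).A)
    (LinearPair.exists_surjective_A hP₁)
  have hP₂ : (P.stage₂ (n₁ + 1) (n₂ + 1)).IsFinite := hP₁.iterate_reduce₂ n₂
  have h₁' : Function.Surjective (P.stage₂ (n₁ + 1) (n₂ + 1)).B :=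
    LinearPair.surjective_B_iterate_reduce₂ h₁ n₂
  obtain ⟨n₃, hn₃, h₃⟩ := exists_isLeast_stage
    (fun n => Function.Bijective (LinearPair.reduce₃^[n] (P.stage₂ (n₁ + 1) (n₂ + 1))).B)
    (LinearPair.exists_bijective_B hP₂ ⟨h₂, h₁'⟩)
  have hP₃ : (P.stage₃ (n₁ + 1) (n₂ + 1) (n₃ + 1)).IsFinite := hP₂.iterate_reduce₃ n₃
  have hB : Function.Bijective (P.stage₃ (n₁ + 1) (n₂ + 1) (n₃ + 1)).B := h₃
  have hA : Function.Bijective (P.stage₃ (n₁ + 1) (n₂ + 1) (n₃ + 1)).A := by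
    have hs : Function.Surjective (P.stage₃ (n₁ + 1) (n₂ + 1) (n₃ + 1)).A :=
      (LinearPair.surjective_iterate_reduce₃ ⟨h₂, h₁'⟩ n₃).1
    have := hP₃.1
    have := hP₃.2
    -- The bijection B shows that both spaces have the same dimension, so the surjective A is
    -- injective.
    exact ⟨(LinearMap.injective_iff_surjective_of_finrank_eq_finrank
      (LinearEquiv.ofBijective _ hB).finrank_eq).2 hs, hs⟩
  have main := fun M hM => P.exists_blocks hP n₁ n₂ n₃ h₁ h₂ M hM (hM.isNonsingular hA hB).2
  -- Fixed before any matrix pair is chosen, so that the same blocks serve for all of them. In the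
  -- relevant range `toNat` loses nothing: the integer is the cardinality of a set of blocks, as any
  -- one pair `M₀` shows.
  let μ : BlockKind → ℕ → ℕ := fun t j => (P.multiplicity (n₁ + 1) (n₂ + 1) t j).toNat
  obtain ⟨M₀, hM₀⟩ := LinearPair.exists_isGivenBy hP₃
  have hμ : ∀ t j, 1 ≤ j → j < sizeBound (n₁ + 1) (n₂ + 1) (n₃ + 1) t →
      (μ t j : ℤ) = P.multiplicity (n₁ + 1) (n₂ + 1) t j := by
    intro t j hj hjt
    obtain ⟨ι, _, _, s, k, -, hc, -⟩ := main M₀ hM₀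
    refine Int.toNat_of_nonneg ?_
    rw [← hc t j hj hjt]
    exact Int.natCast_nonneg _
  have hgiven : ∀ M : MatrixPair F, (P.stage₃ (n₁ + 1) (n₂ + 1) (n₃ + 1)).IsGivenBy M →
      P.IsGivenBy (M.oplus (MatrixPair.directSum
        (blockFamily F (sizeBound (n₁ + 1) (n₂ + 1) (n₃ + 1)) μ))) := by
    intro M hM
    obtain ⟨ι, _, _, s, k, hk, hc, hg⟩ := main M hM
    obtain ⟨e, he⟩ := exists_equiv_blockIndex F s k
      (sizeBound (n₁ + 1) (n₂ + 1) (n₃ + 1)) μ hk fun t j hj hjt => by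
        have h := hc t j hj hjt
        rw [← hμ t j hj hjt] at h
        exact_mod_cast h
    have h := hg.directSum_reindex e
    rwa [funext he] at h
  refine ⟨n₁ + 1, n₂ + 1, n₃ + 1, hn₁, hn₂, hn₃, μ, hμ .LRT, hμ .IJ, hμ .JI, hμ .LR,
    ⟨M₀, hM₀⟩, fun M hM => ⟨(hM.isNonsingular hA hB).1, (hM.isNonsingular hA hB).2, hgiven M hM⟩,
    LinearPair.exists_isGivenBy_idPair hP₃ hA, fun r D hD X hX =>
    ⟨(hD.isNonsingular hA hB).2, fun x => ⟨x.1, x.2.1, (Finset.mem_Ico.1 x.2.1.2).1, rfl⟩,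
      hX.isEquivalent (hgiven _ hD)⟩⟩
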